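/- Let $A=(a_{ij})_{1\le i,j\le n}$ be a generalized Cartan matrix ($a_{ii}=2$, $a_{ij}\in\mathbb Z_{\le 0}$ for $i\ne j$, $a_{ij}\neq 0\iff a_{ji}\ne 0$) with symmetrizer $D=\mathrm{diag}(d_1,\dots,d_n)$, i.e. the $d_i$ are positive integers with $d_ia_{ij}=d_ja_{ji}$, and assume that $d_1,\dots,d_n$ are relatively prime, $\gcd(d_1,\dots,d_n)=1$. Put $I=\{1,\dots,n\}$. **Positive Yangian.** $Y^+_\hbar(\mathfrak g_{A,D})$ is the associative unital $\mathbb Q[\hbar]$-algebra with generators $x_{k,r}$ ($k\in I$, $r\in\mathbb N$) and relations, for all $k,l\in I$ and $r,s\ge 0$, $$x_{k,r+1}x_{l,s}-x_{k,r}x_{l,s+1}-\tfrac{d_ka_{kl}\hbar}{2}x_{k,r}x_{l,s}=x_{l,s}x_{k,r+1}-x_{l,s+1}x_{k,r}+\tfrac{d_ka_{kl}\hbar}{2}x_{l,s}x_{k,r},$$ and, for all $k\neq l$ with $N=1-a_{kl}$ and all $r_1,\dots,r_N,s\ge0$, $$\sum_{\sigma\in\mathfrak S_N}[x_{k,r_{\sigma(1)}},[x_{k,r_{\sigma(2)}},\dots,[x_{k,r_{\sigma(N)}},x_{l,s}]\dots]]=0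 .$$ **Quiver and weights.** Let $Q$ be the quiver with vertex set $I$ and, for each $i<j$, $m_{ij}=\gcd(a_{ij},a_{ji})$ arrows $h_1,\dots,h_{m_{ij}}$ from $i$ to $j$ (none if $a_{ij}=0$); write $\mathrm{out}(h)=i$, $\mathrm{in}(h)=j$, and let $H$ be the set of all arrows. If $m_{ij}\neq0$ put $l_{ij}=|a_{ij}|/m_{ij}$, $l_{ji}=|a_{ji}|/m_{ij}$ and $e_{ij}=d_il_{ij}=d_jl_{ji}$. The weights are $\mathbf m_i=d_i$, $\mathbf m_{h_p}=(m_{ij}+2-2p)e_{ij}$, $\mathbf m_{h_p^*}=(-m_{ij}+2p)e_{ij}$. **Shuffle algebra.** Specialize $t_1=t_2=\hbar/2$, $t_3=-\hbar$. For $v\in\mathbb N^I$ let $\mathcal{SH}_v=\mathbb C[\hbar][\lambda^i_s : i\in I,\,1\le s\le v^i]^{\prod_i\mathfrak S_{v^i}}$. The sign-twisted shuffle algebra is $\widetilde{\mathcal{SH}}=\bigoplus_v\mathcal{SH}_v$ with the product which for $f_1\in\mathcal{SH}_{v_1}$, $f_2\in\mathcal{SH}_{v_2}$ is $$f_1\star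 f_2=(-1)^{\sum_{h\in H}v_1^{\mathrm{in}(h)}v_2^{\mathrm{out}(h)}}\sum_{\sigma\in \mathrm{Sh}(v_1,v_2)}\sigma\big(f_1(\lambda')f_2(\lambda'')\,\mathrm{fac}_1\,\mathrm{fac}_2\big)\in\mathcal{SH}_{v_1+v_2},$$ where $\lambda'^i_s=\lambda^i_s$, $\lambda''^i_t=\lambda^i_{v_1^i+t}$, $\mathrm{Sh}(v_1,v_2)=\prod_i\mathrm{Sh}(v_1^i,v_2^i)$ is the set of shuffles (permutations that are increasing on the first $v_1^i$ and on the last $v_2^i$ indices for each $i$), $\sigma(\lambda^i_s)=\lambda^i_{\sigma_i(s)}$, and $$\mathrm{fac}_1=\prod_{i\in I}\prod_{s=1}^{v_1^i}\prod_{t=1}^{v_2^i}\frac{\lambda''^i_t-\lambda'^i_s+\mathbf m_it_3}{\lambda''^i_t-\lambda'^i_s},$$ $$\mathrm{fac}_2=\prod_{h\in H}\Big(\prod_{s=1}^{v_1^{\mathrm{out}(h)}}\prod_{t=1}^{v_2^{\mathrm{in}(h)}}\big(\lambda''^{\mathrm{in}(h)}_t-\lambda'^{\mathrm{out}(h)}_s+\mathbf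 m_ht_1\big)\prod_{s=1}^{v_1^{\mathrm{in}(h)}}\prod_{t=1}^{v_2^{\mathrm{out}(h)}}\big(\lambda''^{\mathrm{out}(h)}_t-\lambda'^{\mathrm{in}(h)}_s+\mathbf m_{h^*}t_2\big)\Big).$$ This is an associative unital $\mathbb C[\hbar]$-algebra. **Theorem.** The assignment $x_{k,r}\mapsto(\lambda^{(k)})^r\in\mathcal{SH}_{e_k}=\mathbb C[\hbar][\lambda^{(k)}]$, where $e_k$ is the $k$-th standard basis vector of $\mathbb N^I$ and $\lambda^{(k)}=\lambda^k_1$, extends to a (necessarily unique) homomorphism of $\mathbb Q[\hbar]$-algebras $Y^+_\hbar(\mathfrak g_{A,D})\to\widetilde{\mathcal{SH}}$. -/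

import Mathlib

open MvPolynomial


namespace ShuffleYangian

noncomputable section

/-- A finite quiver with vertex set `I`, together with the integers `l i j` of a symmetrizer
(only the values at adjacent vertices matter). An arrow `h` goes from `out h` to `inc h`. -/
structure QuiverWithSymmetrizer (I : Type*) where
  Arrow : Type
  [fintypeArrow : Fintype Arrow]
  out : Arrow → I
  inc : Arrow → I
  l : I → I → ℕ

attribute [instance] QuiverWithSymmetrizer.fintypeArrow

/-- A weight function `I ⊔ H ⊔ Hᵒᵖ → ℤ`. -/
structure WeightFunction {I : Type*} (Q : QuiverWithSymmetrizer I) where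
  vertex : I → ℤ
  arrow : Q.Arrow → ℤ
  opArrow : Q.Arrow → ℤ

/-- The data defining a shuffle algebra over `R`: a quiver with symmetrizer, a weight function and
the (specialized) equivariant parameters `t₁, t₂, t₃ ∈ R`. -/
structure ShuffleDatum (I R : Type*) where
  quiver : QuiverWithSymmetrizer I
  weight : WeightFunction quiver
  t₁ : R
  t₂ : R
  t₃ : R

/-- The variables `λ^i_s`, `i ∈ I`, `1 ≤ s ≤ v^i` (indexed from `0` here). -/
abbrev Var {I : Type*} (v : I → ℕ) : Type _ := Σ i, Fin (v i)

section Setup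

variable {I : Type*} {R : Type*} [CommRing R]

/-- The action of `𝔖_v = ∏ i, 𝔖_{v^i}` on the variables. -/
def permVar {v : I → ℕ} (σ : ∀ i, Equiv.Perm (Fin (v i))) : Equiv.Perm (Var v) :=
  Equiv.sigmaCongrRight σ

/-- The degree `v` piece `R[λ^i_s]^{𝔖_v}` of the shuffle algebra. -/
def SHDeg (R : Type*) [CommRing R] (v : I → ℕ) : Subalgebra R (MvPolynomial (Var v) R) where
  carrier := {p | ∀ σ : ∀ i, Equiv.Perm (Fin (v i)), rename (permVar σ) p = p}
  mul_mem' := by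
    intro a b ha hb σ
    rw [map_mul, ha σ, hb σ]
  add_mem' := by
    intro a b ha hb σ
    rw [map_add, ha σ, hb σ]
  algebraMap_mem' := by
    intro r σ
    exact AlgHom.commutes _ r

/-- The position of the variable `λ'^i_s` of the first factor among the variables of degree
`v₁ + v₂`. -/
def inlVar (v₁ v₂ : I → ℕ) (a : Var v₁) : Var (v₁ + v₂) := ⟨a.1, Fin.castAdd (v₂ a.1) a.2⟩

/-- The position of the variable `λ''^i_t` of the second factor among the variables of degree
`v₁ + v₂`. -/
def inrVar (v₁ v₂ : I → ℕ) (b : Var v₂) : Var (v₁ + v₂) := ⟨b.1, Fin.natAdd (v₁ b.1) b.2⟩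

open Classical in
/-- The set `Sh(v₁, v₂) = ∏ i, Sh(v₁^i, v₂^i)` of shuffles. -/
def shuffles [Fintype I] (v₁ v₂ : I → ℕ) : Finset (∀ i, Equiv.Perm (Fin ((v₁ + v₂) i))) :=
  Finset.univ.filter fun σ => ∀ i,
    StrictMono (fun s : Fin (v₁ i) => σ i (Fin.castAdd (v₂ i) s)) ∧
    StrictMono (fun t : Fin (v₂ i) => σ i (Fin.natAdd (v₁ i) t))

variable (S : ShuffleDatum I R) {K : Type*} [Field K] [Algebra R K] {v₁ v₂ : I → ℕ}

/-- The factor `fac₁`, with `λ' = x` and `λ'' = y`. -/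
def fac₁ [Fintype I] (x : Var v₁ → K) (y : Var v₂ → K) : K :=
  ∏ i, ∏ s : Fin (v₁ i), ∏ t : Fin (v₂ i),
    (y ⟨i, t⟩ - x ⟨i, s⟩ + algebraMap R K (S.weight.vertex i * S.t₃)) / (y ⟨i, t⟩ - x ⟨i, s⟩)

/-- The factor `fac₂`, with `λ' = x` and `λ'' = y`. -/
def fac₂ (x : Var v₁ → K) (y : Var v₂ → K) : K :=
  ∏ h : S.quiver.Arrow,
    ((∏ s : Fin (v₁ (S.quiver.out h)), ∏ t : Fin (v₂ (S.quiver.inc h)),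
        (y ⟨S.quiver.inc h, t⟩ - x ⟨S.quiver.out h, s⟩
          + algebraMap R K (S.weight.arrow h * S.t₁))) *
      ∏ s : Fin (v₁ (S.quiver.inc h)), ∏ t : Fin (v₂ (S.quiver.out h)),
        (y ⟨S.quiver.out h, t⟩ - x ⟨S.quiver.inc h, s⟩
          + algebraMap R K (S.weight.opArrow h * S.t₂)))

/-- The value at the point `λ = x` of `∑_{σ ∈ Sh(v₁,v₂)} σ(f · g · fac₁ · fac₂)`, where
`σ(λ^i_s) = λ^i_{σ(s)}`. -/
def shuffleSum [Fintype I] (f : MvPolynomial (Var v₁) R) (g : MvPolynomial (Var v₂) R)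
    (x : Var (v₁ + v₂) → K) : K :=
  ∑ σ ∈ shuffles v₁ v₂,
    aeval (fun a => x (permVar σ (inlVar v₁ v₂ a))) f *
    aeval (fun b => x (permVar σ (inrVar v₁ v₂ b))) g *
    fac₁ S (fun a => x (permVar σ (inlVar v₁ v₂ a))) (fun b => x (permVar σ (inrVar v₁ v₂ b))) *
    fac₂ S (fun a => x (permVar σ (inlVar v₁ v₂ a))) (fun b => x (permVar σ (inrVar v₁ v₂ b)))

/-- The field of rational functions in the variables of degree `v`. -/
abbrev RatFun (R : Type*) [CommRing R] (v : I → ℕ) : Type _ :=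
  FractionRing (MvPolynomial (Var v) R)

/-- The variable `λ^i_s` as a rational function. -/
def lam (R : Type*) [CommRing R] {v : I → ℕ} (a : Var v) : RatFun R v :=
  algebraMap (MvPolynomial (Var v) R) (RatFun R v) (X a)

/-- The exponent `∑_{h ∈ H} v₁^{inc h} v₂^{out h}` of the sign twist. -/
def signExp (v₁ v₂ : I → ℕ) : ℕ :=
  ∑ h : S.quiver.Arrow, v₁ (S.quiver.inc h) * v₂ (S.quiver.out h)

end Setup

/-! ### The shuffle product is a symmetric polynomial -/

section Polynomiality

section Divisibility

variable {V R : Type*} [CommRing R]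

open Classical in
lemma sub_dvd_iff (u w : V) (Q : MvPolynomial V R) :
    (X w - X u : MvPolynomial V R) ∣ Q ↔ rename (Function.update id u w) Q = 0 := by
  constructor
  · rintro ⟨c, rfl⟩
    rw [map_mul, map_sub, rename_X, rename_X]
    by_cases h : w = u
    · subst h; simp
    · simp [Function.update_of_ne h]
  · intro h
    rw [← Ideal.mem_span_singleton, ← Ideal.Quotient.eq_zero_iff_mem]
    have key : (Ideal.Quotient.mkₐ R (Ideal.span {(X w - X u : MvPolynomial V R)})).comp
        (rename (Function.update id u w)) = Ideal.Quotient.mkₐ R _ := by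
      apply MvPolynomial.algHom_ext
      intro i
      simp only [AlgHom.comp_apply, rename_X]
      by_cases hi : i = u
      · subst hi
        simp only [Function.update_self, Ideal.Quotient.mkₐ_eq_mk]
        rw [Ideal.Quotient.eq]
        exact Ideal.mem_span_singleton_self _
      · simp [Function.update_of_ne hi]
    have := congrArg (fun φ => φ Q) key
    simp only [AlgHom.comp_apply, h, map_zero, Ideal.Quotient.mkₐ_eq_mk] at this
    exact this.symm

lemma sub_prime [IsDomain R] {u w : V} (h : u ≠ w) : Prime (X w - X u : MvPolynomial V R) := by
  classical
  refine ⟨?_, ?_, ?_⟩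
  · rw [sub_ne_zero]
    exact fun e => h (MvPolynomial.X_injective e).symm
  · intro hu
    have := (sub_dvd_iff (R := R) u w 1).1 hu.dvd
    simp at this
  · intro a b hab
    rw [sub_dvd_iff, map_mul, mul_eq_zero] at hab
    rwa [sub_dvd_iff, sub_dvd_iff]

lemma sub_not_dvd [IsDomain R] {u w u' w' : V} (h : u' ≠ w') (h1 : ¬ (u' = u ∧ w' = w))
    (h2 : ¬ (u' = w ∧ w' = u)) :
    ¬ (X w - X u : MvPolynomial V R) ∣ X w' - X u' := by
  classical
  rw [sub_dvd_iff, map_sub, rename_X, rename_X, sub_eq_zero]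
  intro e
  have e := MvPolynomial.X_injective e
  simp only [Function.update_apply, id] at e
  split_ifs at e <;> grind

lemma prod_sub_dvd [IsDomain R] {ι : Type*} (s : Finset ι) (u w : ι → V)
    (hne : ∀ a ∈ s, u a ≠ w a)
    (h1 : ∀ a ∈ s, ∀ b ∈ s, a ≠ b → ¬ (u a = u b ∧ w a = w b))
    (h2 : ∀ a ∈ s, ∀ b ∈ s, a ≠ b → ¬ (u a = w b ∧ w a = u b))
    (Q : MvPolynomial V R) (hQ : ∀ a ∈ s, (X (w a) - X (u a) : MvPolynomial V R) ∣ Q) :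
    (∏ a ∈ s, (X (w a) - X (u a) : MvPolynomial V R)) ∣ Q := by
  classical
  induction s using Finset.induction_on with
  | empty => simp
  | insert a s ha ih =>
    obtain ⟨c, hc⟩ := ih (fun b hb => hne b (Finset.mem_insert_of_mem hb))
      (fun b hb c hc => h1 b (Finset.mem_insert_of_mem hb) c (Finset.mem_insert_of_mem hc))
      (fun b hb c hc => h2 b (Finset.mem_insert_of_mem hb) c (Finset.mem_insert_of_mem hc))
      (fun b hb => hQ b (Finset.mem_insert_of_mem hb))
    have hp := sub_prime (R := R) (hne a (Finset.mem_insert_self a s))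
    have hd := hQ a (Finset.mem_insert_self a s)
    rw [hc] at hd
    have hnd : ¬ (X (w a) - X (u a) : MvPolynomial V R) ∣
        ∏ b ∈ s, (X (w b) - X (u b) : MvPolynomial V R) := by
      rw [hp.dvd_finsetProd_iff]
      rintro ⟨b, hb, hdb⟩
      have hba : b ≠ a := fun e => ha (e ▸ hb)
      exact sub_not_dvd (hne b (Finset.mem_insert_of_mem hb))
        (h1 b (Finset.mem_insert_of_mem hb) a (Finset.mem_insert_self a s) hba)
        (h2 b (Finset.mem_insert_of_mem hb) a (Finset.mem_insert_self a s) hba) hdb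
    obtain ⟨e, he⟩ := (hp.dvd_or_dvd hd).resolve_left hnd
    rw [Finset.prod_insert ha, hc, he]
    exact ⟨e, by ring⟩

lemma sub_dvd_of_antisymm [IsDomain R] [CharZero R] {u w : V} {τ : V → V} (hu : τ u = w)
    (hw : τ w = u) (ho : ∀ a, a ≠ u → a ≠ w → τ a = a)
    {Q : MvPolynomial V R} (hQ : rename τ Q = -Q) :
    (X w - X u : MvPolynomial V R) ∣ Q := by
  classical
  rw [sub_dvd_iff]
  have h : rename (Function.update id u w) (rename τ Q)
      = rename (Function.update id u w) Q := by
    rw [rename_rename]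
    congr 2
    funext a
    simp only [Function.comp, Function.update_apply, id]
    grind
  rw [hQ, map_neg] at h
  exact self_eq_neg.1 h.symm

end Divisibility

variable {I : Type*} [Fintype I] {R : Type*} [CommRing R]
variable (S : ShuffleDatum I R) {K : Type*} [Field K] [Algebra R K] {v₁ v₂ : I → ℕ}

/-- Choices of the positions of the variables of the first factor. -/
def Sub (v₁ v₂ : I → ℕ) : Type _ :=
  {A : ∀ i, Finset (Fin ((v₁ + v₂) i)) // ∀ i, (A i).card = v₁ i}

instance : Finite (Sub v₁ v₂) := by unfold Sub; infer_instance

instance : Fintype (Sub v₁ v₂) := Fintype.ofFinite _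

lemma Sub.card_compl (A : Sub v₁ v₂) (i : I) : (A.1 i)ᶜ.card = v₂ i := by
  rw [Finset.card_compl, A.2 i, Fintype.card_fin, Pi.add_apply, Nat.add_sub_cancel_left]

def Sub.left (A : Sub v₁ v₂) (a : Var v₁) : Var (v₁ + v₂) :=
  ⟨a.1, (A.1 a.1).orderEmbOfFin (A.2 a.1) a.2⟩

def Sub.right (A : Sub v₁ v₂) (b : Var v₂) : Var (v₁ + v₂) :=
  ⟨b.1, (A.1 b.1)ᶜ.orderEmbOfFin (A.card_compl b.1) b.2⟩

lemma mem_shuffles {σ : ∀ i, Equiv.Perm (Fin ((v₁ + v₂) i))} : σ ∈ shuffles v₁ v₂ ↔ ∀ i,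
    StrictMono (fun s : Fin (v₁ i) => σ i (Fin.castAdd (v₂ i) s)) ∧
    StrictMono (fun t : Fin (v₂ i) => σ i (Fin.natAdd (v₁ i) t)) := by
  classical
  simp [shuffles]

/-- The subset attached to a shuffle. -/
def Sub.ofPerm (v₁ v₂ : I → ℕ) (σ : ∀ i, Equiv.Perm (Fin ((v₁ + v₂) i))) : Sub v₁ v₂ :=
  ⟨fun i => Finset.univ.map ⟨fun s : Fin (v₁ i) => σ i (Fin.castAdd (v₂ i) s),
      (σ i).injective.comp (Fin.castAdd_injective _ _)⟩, fun i => by simp⟩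

lemma Sub.left_ofPerm {σ : ∀ i, Equiv.Perm (Fin ((v₁ + v₂) i))} (hσ : σ ∈ shuffles v₁ v₂)
    (a : Var v₁) : (Sub.ofPerm v₁ v₂ σ).left a = permVar σ (inlVar v₁ v₂ a) := by
  obtain ⟨i, s⟩ := a
  have h := Finset.orderEmbOfFin_unique ((Sub.ofPerm v₁ v₂ σ).2 i)
    (f := fun s : Fin (v₁ i) => σ i (Fin.castAdd (v₂ i) s))
    (fun s => by simp [Sub.ofPerm]) (mem_shuffles.1 hσ i).1
  exact congrArg (Sigma.mk i) (congrFun h s).symm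

lemma Sub.right_ofPerm {σ : ∀ i, Equiv.Perm (Fin ((v₁ + v₂) i))} (hσ : σ ∈ shuffles v₁ v₂)
    (b : Var v₂) : (Sub.ofPerm v₁ v₂ σ).right b = permVar σ (inrVar v₁ v₂ b) := by
  obtain ⟨i, t⟩ := b
  have h := Finset.orderEmbOfFin_unique ((Sub.ofPerm v₁ v₂ σ).card_compl i)
    (f := fun t : Fin (v₂ i) => σ i (Fin.natAdd (v₁ i) t))
    (fun t => by
      simp only [Sub.ofPerm, Finset.mem_compl, Finset.mem_map, Finset.mem_univ, true_and,
        Function.Embedding.coeFn_mk, not_exists]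
      intro s hs
      have := congrArg Fin.val ((σ i).injective hs)
      simp at this
      omega) (mem_shuffles.1 hσ i).2
  exact congrArg (Sigma.mk i) (congrFun h t).symm

lemma Sub.exists_perm (A : Sub v₁ v₂) : ∃ σ ∈ shuffles v₁ v₂, Sub.ofPerm v₁ v₂ σ = A := by
  refine ⟨fun i => (finSumFinEquiv.symm.trans
    (finSumEquivOfFinset (A.2 i) (A.card_compl i)) :
      Fin (v₁ i + v₂ i) ≃ Fin ((v₁ + v₂) i)), ?_, ?_⟩
  · rw [mem_shuffles]
    intro i
    constructor
    · intro a b hab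
      simpa using hab
    · intro a b hab
      simpa using hab
  · apply Subtype.ext
    funext i
    ext a
    have h1 : ∀ s : Fin (v₁ i), (finSumEquivOfFinset (A.2 i) (A.card_compl i))
        (finSumFinEquiv.symm (Fin.castAdd (v₂ i) s)) = (A.1 i).orderEmbOfFin (A.2 i) s := by
      intro s
      rw [finSumFinEquiv_symm_apply_castAdd]
      rfl
    have h2 := Set.ext_iff.1 (Finset.range_orderEmbOfFin (A.1 i) (A.2 i)) a
    simp only [Set.mem_range, ← h1, Finset.mem_coe] at h2
    simpa [Sub.ofPerm] using h2

lemma Sub.ofPerm_injOn : Set.InjOn (Sub.ofPerm v₁ v₂) (shuffles v₁ v₂) := by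
  intro σ hσ τ hτ h
  funext i
  ext a
  have hl := fun s => (Sub.left_ofPerm hσ ⟨i, s⟩).symm.trans
    ((congrArg (fun A => Sub.left A ⟨i, s⟩) h).trans (Sub.left_ofPerm hτ ⟨i, s⟩))
  have hr := fun s => (Sub.right_ofPerm hσ ⟨i, s⟩).symm.trans
    ((congrArg (fun A => Sub.right A ⟨i, s⟩) h).trans (Sub.right_ofPerm hτ ⟨i, s⟩))
  simp only [permVar, inlVar, inrVar, Equiv.sigmaCongrRight_apply, Sigma.map, Sigma.mk.injEq,
    heq_eq_eq, true_and] at hl hr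
  refine congrArg Fin.val ?_
  refine Fin.addCases (motive := fun a => σ i a = τ i a) (fun s => hl s) (fun t => hr t) a

/-- The summand of the shuffle product attached to a choice of positions. -/
def subTerm (f : MvPolynomial (Var v₁) R) (g : MvPolynomial (Var v₂) R)
    (x : Var (v₁ + v₂) → K) (A : Sub v₁ v₂) : K :=
  aeval (fun a => x (A.left a)) f * aeval (fun b => x (A.right b)) g *
    fac₁ S (fun a => x (A.left a)) (fun b => x (A.right b)) *
    fac₂ S (fun a => x (A.left a)) (fun b => x (A.right b))

lemma shuffleSum_eq (f : MvPolynomial (Var v₁) R) (g : MvPolynomial (Var v₂) R)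
    (x : Var (v₁ + v₂) → K) :
    shuffleSum S f g x = ∑ A : Sub v₁ v₂, subTerm S f g x A := by
  refine Finset.sum_bij (fun σ _ => Sub.ofPerm v₁ v₂ σ) (fun _ _ => Finset.mem_univ _)
    (fun σ hσ τ hτ h => Sub.ofPerm_injOn hσ hτ h) (fun A _ => ?_) (fun σ hσ => ?_)
  · obtain ⟨σ, hσ, h⟩ := A.exists_perm
    exact ⟨σ, hσ, h⟩
  · simp only [subTerm, Sub.left_ofPerm hσ, Sub.right_ofPerm hσ]

lemma exists_perm_of_range {n : ℕ} {α : Type*} {a b : Fin n → α} (ha : Function.Injective a)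
    (hb : Function.Injective b) (h : Set.range a = Set.range b) :
    ∃ ρ : Equiv.Perm (Fin n), ∀ s, a s = b (ρ s) := by
  refine ⟨(Equiv.ofInjective a ha).trans ((Equiv.setCongr h).trans
    (Equiv.ofInjective b hb).symm), fun s => ?_⟩
  have := Equiv.apply_ofInjective_symm hb ((Equiv.setCongr h) (Equiv.ofInjective a ha s))
  simpa using this.symm

lemma aeval_perm {v : I → ℕ} {f : MvPolynomial (Var v) R} (hf : f ∈ SHDeg R v)
    (ρ : ∀ i, Equiv.Perm (Fin (v i))) (x : Var v → K) :
    aeval (fun a => x (permVar ρ a)) f = aeval x f := by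
  conv_rhs => rw [← hf ρ, aeval_rename]
  rfl

lemma fac₁_perm (ρ : ∀ i, Equiv.Perm (Fin (v₁ i))) (ρ' : ∀ i, Equiv.Perm (Fin (v₂ i)))
    (x : Var v₁ → K) (y : Var v₂ → K) :
    fac₁ S (fun a => x (permVar ρ a)) (fun b => y (permVar ρ' b)) = fac₁ S x y := by
  unfold fac₁
  refine Finset.prod_congr rfl fun i _ => ?_
  refine Fintype.prod_equiv (ρ i) _ _ fun s => ?_
  refine Fintype.prod_equiv (ρ' i) _ _ fun t => ?_
  rfl

lemma fac₂_perm (ρ : ∀ i, Equiv.Perm (Fin (v₁ i))) (ρ' : ∀ i, Equiv.Perm (Fin (v₂ i)))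
    (x : Var v₁ → K) (y : Var v₂ → K) :
    fac₂ S (fun a => x (permVar ρ a)) (fun b => y (permVar ρ' b)) = fac₂ S x y := by
  unfold fac₂
  refine Finset.prod_congr rfl fun h _ => ?_
  congr 1
  · refine Fintype.prod_equiv (ρ _) _ _ fun s => ?_
    refine Fintype.prod_equiv (ρ' _) _ _ fun t => ?_
    rfl
  · refine Fintype.prod_equiv (ρ _) _ _ fun s => ?_
    refine Fintype.prod_equiv (ρ' _) _ _ fun t => ?_
    rfl

/-- The action of `𝔖_v` on choices of positions. -/
def Sub.act (τ : ∀ i, Equiv.Perm (Fin ((v₁ + v₂) i))) : Equiv.Perm (Sub v₁ v₂) where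
  toFun A := ⟨fun i => (A.1 i).map (τ i).toEmbedding, fun i => by simp [A.2 i]⟩
  invFun A := ⟨fun i => (A.1 i).map (τ i).symm.toEmbedding, fun i => by simp [A.2 i]⟩
  left_inv A := by
    apply Subtype.ext; funext i; ext a; simp
  right_inv A := by
    apply Subtype.ext; funext i; ext a; simp

lemma Sub.left_act (τ : ∀ i, Equiv.Perm (Fin ((v₁ + v₂) i))) (A : Sub v₁ v₂) :
    ∃ ρ : ∀ i, Equiv.Perm (Fin (v₁ i)), ∀ a,
      permVar τ (A.left a) = (Sub.act τ A).left (permVar ρ a) := by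
  have : ∀ i, ∃ ρ : Equiv.Perm (Fin (v₁ i)), ∀ s, τ i ((A.1 i).orderEmbOfFin (A.2 i) s) =
      ((Sub.act τ A).1 i).orderEmbOfFin ((Sub.act τ A).2 i) (ρ s) := by
    intro i
    apply exists_perm_of_range
    · exact (τ i).injective.comp ((A.1 i).orderEmbOfFin (A.2 i)).injective
    · exact (RelEmbedding.injective _)
    · rw [Finset.range_orderEmbOfFin]
      change Set.range ((τ i) ∘ ((A.1 i).orderEmbOfFin (A.2 i))) = _
      rw [Set.range_comp, Finset.range_orderEmbOfFin]
      exact (Finset.coe_map (τ i).toEmbedding (A.1 i)).symm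
  choose ρ hρ using this
  exact ⟨ρ, fun a => congrArg (Sigma.mk a.1) (hρ a.1 a.2)⟩

lemma Sub.right_act (τ : ∀ i, Equiv.Perm (Fin ((v₁ + v₂) i))) (A : Sub v₁ v₂) :
    ∃ ρ : ∀ i, Equiv.Perm (Fin (v₂ i)), ∀ a,
      permVar τ (A.right a) = (Sub.act τ A).right (permVar ρ a) := by
  have : ∀ i, ∃ ρ : Equiv.Perm (Fin (v₂ i)),
      ∀ s, τ i ((A.1 i)ᶜ.orderEmbOfFin (A.card_compl i) s) =
      ((Sub.act τ A).1 i)ᶜ.orderEmbOfFin ((Sub.act τ A).card_compl i) (ρ s) := by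
    intro i
    apply exists_perm_of_range
    · exact (τ i).injective.comp (RelEmbedding.injective _)
    · exact (RelEmbedding.injective _)
    · rw [Finset.range_orderEmbOfFin]
      change Set.range ((τ i) ∘ ((A.1 i)ᶜ.orderEmbOfFin (A.card_compl i))) = _
      rw [Set.range_comp, Finset.range_orderEmbOfFin]
      rw [Finset.coe_compl, Finset.coe_compl, Set.image_compl_eq (τ i).bijective]
      exact congrArg compl (Finset.coe_map (τ i).toEmbedding (A.1 i)).symm
  choose ρ hρ using this
  exact ⟨ρ, fun a => congrArg (Sigma.mk a.1) (hρ a.1 a.2)⟩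

lemma shuffleSum_perm {f : MvPolynomial (Var v₁) R} {g : MvPolynomial (Var v₂) R}
    (hf : f ∈ SHDeg R v₁) (hg : g ∈ SHDeg R v₂) (x : Var (v₁ + v₂) → K)
    (τ : ∀ i, Equiv.Perm (Fin ((v₁ + v₂) i))) :
    shuffleSum S f g (fun a => x (permVar τ a)) = shuffleSum S f g x := by
  rw [shuffleSum_eq, shuffleSum_eq]
  refine Fintype.sum_equiv (Sub.act τ) _ _ fun A => ?_
  obtain ⟨ρ, hρ⟩ := Sub.left_act τ A
  obtain ⟨ρ', hρ'⟩ := Sub.right_act τ A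
  unfold subTerm
  simp only [hρ, hρ']
  rw [aeval_perm hf ρ (fun a => x ((Sub.act τ A).left a)),
    aeval_perm hg ρ' (fun a => x ((Sub.act τ A).right a)),
    fac₁_perm S ρ ρ' (fun a => x ((Sub.act τ A).left a)) (fun a => x ((Sub.act τ A).right a)),
    fac₂_perm S ρ ρ' (fun a => x ((Sub.act τ A).left a)) (fun a => x ((Sub.act τ A).right a))]

lemma map_shuffleSum {K' : Type*} [Field K'] [Algebra R K'] (ψ : K →ₐ[R] K')
    (f : MvPolynomial (Var v₁) R) (g : MvPolynomial (Var v₂) R) (x : Var (v₁ + v₂) → K) :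
    ψ (shuffleSum S f g x) = shuffleSum S f g (fun a => ψ (x a)) := by
  unfold shuffleSum fac₁ fac₂
  simp only [map_sum, map_mul, map_prod, map_div₀, map_add, map_sub, AlgHom.commutes,
    ← MvPolynomial.comp_aeval_apply]

/-- The Vandermonde polynomial of degree `v`. -/
def vdm (R : Type*) [CommRing R] (v : I → ℕ) : MvPolynomial (Var v) R :=
  ∏ i, (Matrix.vandermonde fun s : Fin (v i) => (X ⟨i, s⟩ : MvPolynomial (Var v) R)).det

lemma vdm_eq (v : I → ℕ) : vdm R v = ∏ p ∈ (Finset.univ : Finset I).sigma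
      (fun i => (Finset.univ : Finset (Fin (v i))).sigma fun s => Finset.Ioi s),
    (X (⟨p.1, p.2.2⟩ : Var v) - X (⟨p.1, p.2.1⟩ : Var v) : MvPolynomial (Var v) R) := by
  unfold vdm
  simp only [Matrix.det_vandermonde, Finset.prod_sigma]

lemma vdm_ne_zero [IsDomain R] (v : I → ℕ) : vdm R v ≠ 0 := by
  rw [vdm_eq, Finset.prod_ne_zero_iff]
  rintro ⟨i, s, t⟩ h
  simp only [Finset.mem_sigma, Finset.mem_univ, Finset.mem_Ioi, true_and] at h
  have hne : (⟨i, s⟩ : Var v) ≠ ⟨i, t⟩ := by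
    intro e
    simp at e
    exact h.ne e
  exact (sub_prime (R := R) hne).ne_zero

lemma vdm_dvd [IsDomain R] {v : I → ℕ} (Q : MvPolynomial (Var v) R)
    (hQ : ∀ (i : I) (s t : Fin (v i)), s < t →
      (X ⟨i, t⟩ - X ⟨i, s⟩ : MvPolynomial (Var v) R) ∣ Q) : vdm R v ∣ Q := by
  rw [vdm_eq]
  refine prod_sub_dvd (R := R) (V := Var v) (ι := Σ i, Σ _ : Fin (v i), Fin (v i))
    (Finset.univ.sigma (fun i => Finset.univ.sigma fun s => Finset.Ioi s))
    (fun p => (⟨p.1, p.2.1⟩ : Var v)) (fun p => (⟨p.1, p.2.2⟩ : Var v)) ?_ ?_ ?_ Q ?_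
  · rintro ⟨i, s, t⟩ h
    simp only [Finset.mem_sigma, Finset.mem_univ, Finset.mem_Ioi, true_and] at h
    intro e
    simp at e
    exact h.ne e
  · rintro ⟨i, s, t⟩ h ⟨i', s', t'⟩ h' hne ⟨e1, e2⟩
    simp only [Sigma.mk.injEq] at e1 e2
    obtain ⟨rfl, e1⟩ := e1
    obtain ⟨_, e2⟩ := e2
    simp only [heq_eq_eq] at e1 e2
    subst e1 e2
    exact hne rfl
  · rintro ⟨i, s, t⟩ h ⟨i', s', t'⟩ h' hne ⟨e1, e2⟩
    simp only [Sigma.mk.injEq] at e1 e2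
    obtain ⟨rfl, e1⟩ := e1
    obtain ⟨_, e2⟩ := e2
    simp only [heq_eq_eq] at e1 e2
    subst e1 e2
    simp only [Finset.mem_sigma, Finset.mem_univ, Finset.mem_Ioi, true_and] at h h'
    exact lt_asymm h h'
  · rintro ⟨i, s, t⟩ h
    simp only [Finset.mem_sigma, Finset.mem_univ, Finset.mem_Ioi, true_and] at h
    exact hQ i s t h

lemma sub_dvd_vdm {v : I → ℕ} (i : I) (s t : Fin (v i)) (h : s ≠ t) :
    (X ⟨i, t⟩ - X ⟨i, s⟩ : MvPolynomial (Var v) R) ∣ vdm R v := by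
  have key : ∀ s t : Fin (v i), s < t →
      (X ⟨i, t⟩ - X ⟨i, s⟩ : MvPolynomial (Var v) R) ∣ vdm R v := by
    intro s t hst
    let x : ∀ i, Fin (v i) → MvPolynomial (Var v) R := fun i s => X ⟨i, s⟩
    have h1 : (Matrix.vandermonde (x i)).det ∣ vdm R v :=
      Finset.dvd_prod_of_mem (fun i => (Matrix.vandermonde (x i)).det) (Finset.mem_univ i)
    have h2 : (∏ t ∈ Finset.Ioi s, (x i t - x i s)) ∣ (Matrix.vandermonde (x i)).det := by
      rw [Matrix.det_vandermonde]
      exact Finset.dvd_prod_of_mem (fun s => ∏ t ∈ Finset.Ioi s, (x i t - x i s))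
        (Finset.mem_univ s)
    have h3 : (x i t - x i s) ∣ ∏ t ∈ Finset.Ioi s, (x i t - x i s) :=
      Finset.dvd_prod_of_mem (fun t => x i t - x i s) (Finset.mem_Ioi.2 hst)
    exact h3.trans (h2.trans h1)
  rcases lt_or_gt_of_ne h with h | h
  · exact key s t h
  · rw [← neg_dvd, neg_sub]
    exact key t s h

lemma rename_vdm {v : I → ℕ} (τ : ∀ i, Equiv.Perm (Fin (v i))) :
    rename (permVar τ) (vdm R v) = (∏ i, ((Equiv.Perm.sign (τ i) : ℤ) : MvPolynomial (Var v) R))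
      * vdm R v := by
  unfold vdm
  rw [map_prod, ← Finset.prod_mul_distrib]
  refine Finset.prod_congr rfl fun i _ => ?_
  rw [← Matrix.det_permute, AlgHom.map_det]
  congr 1
  ext s t
  simp [Matrix.vandermonde, permVar, Sigma.map]

lemma subTerm_mul_vdm [IsDomain R] (f : MvPolynomial (Var v₁) R) (g : MvPolynomial (Var v₂) R)
    (A : Sub v₁ v₂) : ∃ Q : MvPolynomial (Var (v₁ + v₂)) R,
      subTerm S f g (lam R) A * algebraMap _ (RatFun R (v₁ + v₂)) (vdm R (v₁ + v₂))
        = algebraMap _ _ Q := by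
  have hlr : ∀ (i : I) (s : Fin (v₁ i)) (t : Fin (v₂ i)),
      (A.left ⟨i, s⟩).2 ≠ (A.right ⟨i, t⟩).2 := by
    intro i s t e
    have h1 := Finset.orderEmbOfFin_mem (A.1 i) (A.2 i) s
    have h2 := Finset.orderEmbOfFin_mem (A.1 i)ᶜ (A.card_compl i) t
    rw [Finset.mem_compl] at h2
    apply h2
    have e : (A.1 i).orderEmbOfFin (A.2 i) s = (A.1 i)ᶜ.orderEmbOfFin (A.card_compl i) t := e
    rwa [← e]
  set D : MvPolynomial (Var (v₁ + v₂)) R :=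
    ∏ i, ∏ s : Fin (v₁ i), ∏ t : Fin (v₂ i), (X (A.right ⟨i, t⟩) - X (A.left ⟨i, s⟩)) with hD
  have hDne : D ≠ 0 := by
    simp only [hD, Finset.prod_ne_zero_iff]
    intro i _ s _ t _
    have hne : A.left ⟨i, s⟩ ≠ A.right ⟨i, t⟩ := by
      intro e
      have := (Sigma.mk.inj_iff.1 e).2
      exact hlr i s t (eq_of_heq this)
    exact (sub_prime (R := R) hne).ne_zero
  have hDdvd : D ∣ vdm R (v₁ + v₂) := by
    have e : D = ∏ p ∈ (Finset.univ : Finset I).sigma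
      (fun i => (Finset.univ : Finset (Fin (v₁ i))) ×ˢ (Finset.univ : Finset (Fin (v₂ i)))),
        (X (A.right ⟨p.1, p.2.2⟩) - X (A.left ⟨p.1, p.2.1⟩)) := by
      rw [hD]
      simp only [Finset.prod_sigma, Finset.prod_product]
    rw [e]
    refine prod_sub_dvd (R := R) (V := Var (v₁ + v₂)) (ι := Σ i, Fin (v₁ i) × Fin (v₂ i))
      (Finset.univ.sigma fun _ => Finset.univ ×ˢ Finset.univ)
      (fun p => A.left ⟨p.1, p.2.1⟩) (fun p => A.right ⟨p.1, p.2.2⟩)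
      ?_ ?_ ?_ _ ?_
    · rintro ⟨i, s, t⟩ _ e
      exact hlr i s t (eq_of_heq (Sigma.mk.inj_iff.1 e).2)
    · rintro ⟨i, s, t⟩ _ ⟨i', s', t'⟩ _ hne ⟨e1, e2⟩
      obtain ⟨h1, e1⟩ := Sigma.mk.inj_iff.1 e1
      obtain ⟨_, e2⟩ := Sigma.mk.inj_iff.1 e2
      dsimp only at h1
      subst h1
      have e1 : s = s' := (RelEmbedding.injective _) (eq_of_heq e1)
      have e2 : t = t' := (RelEmbedding.injective _) (eq_of_heq e2)
      exact hne (by rw [e1, e2])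
    · rintro ⟨i, s, t⟩ _ ⟨i', s', t'⟩ _ hne ⟨e1, e2⟩
      obtain ⟨h1, e1⟩ := Sigma.mk.inj_iff.1 e1
      dsimp only at h1
      subst h1
      exact hlr i s t' (eq_of_heq e1)
    · rintro ⟨i, s, t⟩ _
      exact sub_dvd_vdm i _ _ (hlr i s t)
  obtain ⟨E, hE⟩ := hDdvd
  let ψ : MvPolynomial (Var (v₁ + v₂)) R →ₐ[R] RatFun R (v₁ + v₂) :=
    IsScalarTower.toAlgHom _ _ _
  have hψ : ∀ p, ψ p = algebraMap _ (RatFun R (v₁ + v₂)) p := fun _ => rfl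
  have hlam : ∀ a, lam R a = ψ (X a) := fun _ => rfl
  have hψ' : ψ = aeval (lam R) := by
    apply MvPolynomial.algHom_ext
    intro a
    rw [aeval_X, hlam]
  have hDne' : ψ D ≠ 0 := by
    rw [hψ]
    exact (map_ne_zero_iff _ (IsFractionRing.injective _ _)).2 hDne
  refine ⟨rename A.left f * rename A.right g *
    (∏ i, ∏ s : Fin (v₁ i), ∏ t : Fin (v₂ i),
      (X (A.right ⟨i, t⟩) - X (A.left ⟨i, s⟩) + algebraMap R _ (S.weight.vertex i * S.t₃))) *
    (∏ h : S.quiver.Arrow,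
    ((∏ s : Fin (v₁ (S.quiver.out h)), ∏ t : Fin (v₂ (S.quiver.inc h)),
        (X (A.right ⟨S.quiver.inc h, t⟩) - X (A.left ⟨S.quiver.out h, s⟩)
          + algebraMap R _ (S.weight.arrow h * S.t₁))) *
      ∏ s : Fin (v₁ (S.quiver.inc h)), ∏ t : Fin (v₂ (S.quiver.out h)),
        (X (A.right ⟨S.quiver.out h, t⟩) - X (A.left ⟨S.quiver.inc h, s⟩)
          + algebraMap R _ (S.weight.opArrow h * S.t₂)))) * E, ?_⟩
  have hf : aeval (fun a => lam R (A.left a)) f = ψ (rename A.left f) := by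
    rw [hψ', aeval_rename]
    rfl
  have hg : aeval (fun a => lam R (A.right a)) g = ψ (rename A.right g) := by
    rw [hψ', aeval_rename]
    rfl
  have gen : ∀ a b N F E D : RatFun R (v₁ + v₂), D ≠ 0 →
      a * b * (N / D) * F * (D * E) = a * b * N * F * E := by
    intro a b N F E D hD
    field_simp
  rw [hE, ← hψ, ← hψ]
  unfold subTerm
  rw [hf, hg]
  unfold fac₁ fac₂
  simp only [Finset.prod_div_distrib, hlam, ← map_sub, ← map_prod, ← hD]
  rw [map_mul ψ D E, gen _ _ _ _ _ _ hDne']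
  simp only [map_mul, map_prod, map_add, AlgHom.commutes]

theorem exists_shuffleProduct [IsDomain R] [CharZero R] (f : SHDeg R v₁) (g : SHDeg R v₂) :
    ∃ p : SHDeg R (v₁ + v₂), algebraMap _ (RatFun R (v₁ + v₂)) p.1
      = shuffleSum S f.1 g.1 (lam R) := by
  classical
  have hinj : Function.Injective (algebraMap (MvPolynomial (Var (v₁ + v₂)) R)
    (RatFun R (v₁ + v₂))) := IsFractionRing.injective _ _
  choose T hT using subTerm_mul_vdm S f.1 g.1
  set Q := ∑ A, T A with hQdef
  have hQ : shuffleSum S f.1 g.1 (lam R) * algebraMap _ (RatFun R (v₁ + v₂)) (vdm R (v₁ + v₂))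
      = algebraMap _ _ Q := by
    rw [shuffleSum_eq, Finset.sum_mul, hQdef, map_sum]
    exact Finset.sum_congr rfl fun A _ => hT A
  have hact : ∀ (τ : ∀ i, Equiv.Perm (Fin ((v₁ + v₂) i))) (p q : MvPolynomial (Var (v₁ + v₂)) R),
      shuffleSum S f.1 g.1 (lam R) * algebraMap _ (RatFun R (v₁ + v₂)) p = algebraMap _ _ q →
      shuffleSum S f.1 g.1 (lam R) * algebraMap _ (RatFun R (v₁ + v₂)) (rename (permVar τ) p)
        = algebraMap _ _ (rename (permVar τ) q) := by
    intro τ p q h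
    let j : MvPolynomial (Var (v₁ + v₂)) R →ₐ[R] RatFun R (v₁ + v₂) :=
      (IsScalarTower.toAlgHom _ _ _).comp (rename (permVar τ))
    have hj : Function.Injective j :=
      hinj.comp (rename_injective _ (permVar τ).injective)
    let ψ : RatFun R (v₁ + v₂) →ₐ[R] RatFun R (v₁ + v₂) := IsFractionRing.liftAlgHom hj
    have hψ : ∀ p, ψ (algebraMap _ _ p) = algebraMap _ _ (rename (permVar τ) p) := fun p =>
      IsFractionRing.lift_algebraMap hj p
    have := congrArg ψ h
    rw [map_mul, hψ, hψ, map_shuffleSum] at this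
    rw [← this]
    congr 1
    rw [← shuffleSum_perm S f.2 g.2 (lam R) τ]
    congr 1
    funext a
    simp only [lam, hψ, rename_X]
  have hdvd : vdm R (v₁ + v₂) ∣ Q := by
    apply vdm_dvd
    intro i s t hst
    let τ : ∀ i, Equiv.Perm (Fin ((v₁ + v₂) i)) :=
      Function.update (fun _ => 1) i (Equiv.swap s t)
    have hτi : τ i = Equiv.swap s t := Function.update_self _ _ _
    have hτj : ∀ j, j ≠ i → τ j = 1 := fun j hj => Function.update_of_ne hj _ _
    refine sub_dvd_of_antisymm (τ := permVar τ) ?_ ?_ ?_ ?_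
    · exact congrArg (Sigma.mk i) (by rw [hτi, Equiv.swap_apply_left])
    · exact congrArg (Sigma.mk i) (by rw [hτi, Equiv.swap_apply_right])
    · rintro ⟨j, a⟩ h1 h2
      refine congrArg (Sigma.mk j) ?_
      by_cases hj : j = i
      · subst hj
        rw [hτi, Equiv.swap_apply_of_ne_of_ne]
        · exact fun e => h1 (congrArg (Sigma.mk j) e)
        · exact fun e => h2 (congrArg (Sigma.mk j) e)
      · simp [hτj j hj]
    have hsign : (∏ j, ((Equiv.Perm.sign (τ j) : ℤ) : MvPolynomial (Var (v₁ + v₂)) R)) = -1 := by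
      rw [Finset.prod_eq_single i]
      · simp [hτi, Equiv.Perm.sign_swap hst.ne]
      · intro j _ hj
        simp [hτj j hj]
      · simp
    have h1 := hact τ _ _ hQ
    rw [rename_vdm, hsign, neg_one_mul, map_neg, mul_neg, hQ, ← map_neg] at h1
    have h2 := hinj h1
    exact h2.symm
  obtain ⟨p, hp⟩ := hdvd
  have hv : algebraMap _ (RatFun R (v₁ + v₂)) (vdm R (v₁ + v₂)) ≠ 0 :=
    (map_ne_zero_iff _ hinj).2 (vdm_ne_zero _)
  have hpe : algebraMap _ (RatFun R (v₁ + v₂)) p = shuffleSum S f.1 g.1 (lam R) := by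
    apply mul_right_cancel₀ hv
    rw [hQ, hp, map_mul, mul_comm]
  refine ⟨⟨p, fun τ => ?_⟩, hpe⟩
  have := hact τ 1 p (by rw [map_one, mul_one, hpe])
  rw [map_one, map_one, mul_one, ← hpe] at this
  exact (hinj this).symm

end Polynomiality

/-! ### The sign-twisted shuffle algebra -/

section Product

variable {I : Type*} [Fintype I] {R : Type*} [CommRing R] [IsDomain R] [CharZero R]
variable (S : ShuffleDatum I R) {v₁ v₂ : I → ℕ}

/-- The untwisted shuffle product `f * g`: the symmetric polynomial which, as a rational function,
is `∑_{σ ∈ Sh(v₁,v₂)} σ(f · g · fac₁ · fac₂)`. -/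
def shuffleProduct (f : SHDeg R v₁) (g : SHDeg R v₂) : SHDeg R (v₁ + v₂) :=
  (exists_shuffleProduct S f g).choose

lemma shuffleProduct_spec (f : SHDeg R v₁) (g : SHDeg R v₂) :
    algebraMap _ (RatFun R (v₁ + v₂)) (shuffleProduct S f g).1 = shuffleSum S f.1 g.1 (lam R) :=
  (exists_shuffleProduct S f g).choose_spec

/-- The sign-twisted shuffle product `f ⋆ g = (-1)^{∑_h v₁^{inc h} v₂^{out h}} f * g`. -/
def twistedProduct (f : SHDeg R v₁) (g : SHDeg R v₂) : SHDeg R (v₁ + v₂) :=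
  (-1 : R) ^ signExp S v₁ v₂ • shuffleProduct S f g

lemma shuffleProduct_unique {f : SHDeg R v₁} {g : SHDeg R v₂} {p : SHDeg R (v₁ + v₂)}
    (h : algebraMap _ (RatFun R (v₁ + v₂)) p.1 = shuffleSum S f.1 g.1 (lam R)) :
    shuffleProduct S f g = p :=
  Subtype.ext (IsFractionRing.injective _ (RatFun R (v₁ + v₂))
    ((shuffleProduct_spec S f g).trans h.symm))

/-- The shuffle product evaluated at algebraically independent elements of a field. -/
lemma aeval_shuffleProduct {K : Type*} [Field K] [Algebra R K] (f : SHDeg R v₁) (g : SHDeg R v₂)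
    (x : Var (v₁ + v₂) → K)
    (hx : Function.Injective (aeval x : MvPolynomial (Var (v₁ + v₂)) R →ₐ[R] K)) :
    aeval x (shuffleProduct S f g).1 = shuffleSum S f.1 g.1 x := by
  let ψ : RatFun R (v₁ + v₂) →ₐ[R] K := IsFractionRing.liftAlgHom hx
  have hψ : ∀ p, ψ (algebraMap _ _ p) = aeval x p := fun p => IsFractionRing.lift_algebraMap hx p
  rw [← hψ, shuffleProduct_spec, map_shuffleSum]
  congr 1
  funext a
  simp only [lam, hψ, aeval_X]

lemma shuffleSum_add_left {K : Type*} [Field K] [Algebra R K] (f f' : MvPolynomial (Var v₁) R)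
    (g : MvPolynomial (Var v₂) R) (x : Var (v₁ + v₂) → K) :
    shuffleSum S (f + f') g x = shuffleSum S f g x + shuffleSum S f' g x := by
  simp only [shuffleSum, map_add, add_mul, Finset.sum_add_distrib]

lemma shuffleSum_add_right {K : Type*} [Field K] [Algebra R K] (f : MvPolynomial (Var v₁) R)
    (g g' : MvPolynomial (Var v₂) R) (x : Var (v₁ + v₂) → K) :
    shuffleSum S f (g + g') x = shuffleSum S f g x + shuffleSum S f g' x := by
  simp only [shuffleSum, map_add, add_mul, mul_add, Finset.sum_add_distrib]

lemma shuffleSum_smul_left {K : Type*} [Field K] [Algebra R K] (c : R)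
    (f : MvPolynomial (Var v₁) R) (g : MvPolynomial (Var v₂) R) (x : Var (v₁ + v₂) → K) :
    shuffleSum S (c • f) g x = c • shuffleSum S f g x := by
  simp only [shuffleSum, map_smul, smul_mul_assoc, Finset.smul_sum]

lemma shuffleSum_smul_right {K : Type*} [Field K] [Algebra R K] (c : R)
    (f : MvPolynomial (Var v₁) R) (g : MvPolynomial (Var v₂) R) (x : Var (v₁ + v₂) → K) :
    shuffleSum S f (c • g) x = c • shuffleSum S f g x := by
  simp only [shuffleSum, map_smul, mul_smul_comm, smul_mul_assoc, Finset.smul_sum]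

lemma algebraMap_smul_ratFun {v : I → ℕ} (c : R) (p : MvPolynomial (Var v) R) :
    algebraMap _ (RatFun R v) (c • p) = c • algebraMap _ (RatFun R v) p :=
  map_smul (IsScalarTower.toAlgHom R (MvPolynomial (Var v) R) (RatFun R v)) c p

/-- The sign-twisted shuffle product as a bilinear map. -/
def twistedBilin (v₁ v₂ : I → ℕ) :
    SHDeg R v₁ →ₗ[R] SHDeg R v₂ →ₗ[R] SHDeg R (v₁ + v₂) :=
  LinearMap.mk₂ R (twistedProduct S)
    (fun f f' g => by
      rw [twistedProduct, twistedProduct, twistedProduct, ← smul_add]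
      congr 1
      apply shuffleProduct_unique
      rw [Subalgebra.coe_add, Subalgebra.coe_add, map_add, shuffleSum_add_left,
        shuffleProduct_spec, shuffleProduct_spec])
    (fun c f g => by
      rw [twistedProduct, twistedProduct, smul_comm]
      congr 1
      apply shuffleProduct_unique
      rw [Subalgebra.coe_smul, Subalgebra.coe_smul, algebraMap_smul_ratFun, shuffleSum_smul_left,
        shuffleProduct_spec])
    (fun f g g' => by
      rw [twistedProduct, twistedProduct, twistedProduct, ← smul_add]
      congr 1
      apply shuffleProduct_unique
      rw [Subalgebra.coe_add, Subalgebra.coe_add, map_add, shuffleSum_add_right,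
        shuffleProduct_spec, shuffleProduct_spec])
    (fun c f g => by
      rw [twistedProduct, twistedProduct, smul_comm]
      congr 1
      apply shuffleProduct_unique
      rw [Subalgebra.coe_smul, Subalgebra.coe_smul, algebraMap_smul_ratFun, shuffleSum_smul_right,
        shuffleProduct_spec])

end Product

open DirectSum

/-- The underlying `R`-module `⨁_v SH_v` of the sign-twisted shuffle algebra. -/
def TwistedShuffle {I R : Type*} [CommRing R] (_S : ShuffleDatum I R) : Type _ :=
  ⨁ v : I → ℕ, SHDeg R v

namespace TwistedShuffle

variable {I : Type*} [Fintype I] {R : Type*} [CommRing R]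
variable (S : ShuffleDatum I R) {v v₁ v₂ : I → ℕ}

instance : AddCommGroup (TwistedShuffle S) :=
  inferInstanceAs (AddCommGroup (⨁ v : I → ℕ, SHDeg R v))

instance : Module R (TwistedShuffle S) :=
  inferInstanceAs (Module R (⨁ v : I → ℕ, SHDeg R v))

/-- The inclusion of the degree `v` piece. -/
def of (v : I → ℕ) : SHDeg R v →ₗ[R] TwistedShuffle S :=
  DirectSum.lof R (I → ℕ) (fun v => SHDeg R v) v

/-- The projection to the degree `v` piece. -/
def comp (v : I → ℕ) : TwistedShuffle S →ₗ[R] SHDeg R v :=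
  DirectSum.component R (I → ℕ) (fun v => SHDeg R v) v

/-- The linear map out of the direct sum with given components. -/
def lift {M : Type*} [AddCommGroup M] [Module R M] (φ : ∀ v : I → ℕ, SHDeg R v →ₗ[R] M) :
    TwistedShuffle S →ₗ[R] M :=
  DirectSum.toModule R (I → ℕ) M φ

lemma lift_of {M : Type*} [AddCommGroup M] [Module R M] (φ : ∀ v : I → ℕ, SHDeg R v →ₗ[R] M)
    (f : SHDeg R v) : lift S φ (of S v f) = φ v f := by
  unfold lift of
  exact DirectSum.toModule_lof (R := R) (ι := I → ℕ) (M := fun v => SHDeg R v) (φ := φ) v f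

lemma comp_of_same (f : SHDeg R v) : comp S v (of S v f) = f :=
  DirectSum.of_eq_same (β := fun v : I → ℕ => SHDeg R v) v f

lemma comp_of_ne {w : I → ℕ} (h : w ≠ v) (f : SHDeg R v) : comp S w (of S v f) = 0 :=
  DirectSum.of_eq_of_ne (β := fun v : I → ℕ => SHDeg R v) v w f h

lemma ext_comp {a b : TwistedShuffle S} (h : ∀ v, comp S v a = comp S v b) : a = b :=
  DFinsupp.ext h

lemma induction_on {p : TwistedShuffle S → Prop} (a : TwistedShuffle S) (h0 : p 0)
    (hof : ∀ v f, p (of S v f)) (hadd : ∀ a b, p a → p b → p (a + b)) : p a :=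
  DirectSum.induction_on a h0 hof hadd

section Ambient

/-- The field of rational functions in the variables `λ^i_s`, `i ∈ I`, `s ∈ ℕ`. -/
abbrev AmbField (I R : Type*) [CommRing R] : Type _ := FractionRing (MvPolynomial (I × ℕ) R)

/-- The variable `λ^i_s` of the ambient field. -/
def ambVar (R : Type*) [CommRing R] (i : I) (s : ℕ) : AmbField I R :=
  algebraMap (MvPolynomial (I × ℕ) R) (AmbField I R) (X (i, s))

variable [IsDomain R]

/-- The structure factor of the ambient algebra. -/
def ambFac (A B : I → Finset ℕ) : AmbField I R :=
  (-1) ^ (∑ h : S.quiver.Arrow, (A (S.quiver.inc h)).card * (B (S.quiver.out h)).card) *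
  (∏ i, ∏ s ∈ A i, ∏ t ∈ B i,
    (ambVar R i t - ambVar R i s + algebraMap R (AmbField I R) (S.weight.vertex i * S.t₃)) /
      (ambVar R i t - ambVar R i s)) *
  ∏ h : S.quiver.Arrow,
    ((∏ s ∈ A (S.quiver.out h), ∏ t ∈ B (S.quiver.inc h),
        (ambVar R (S.quiver.inc h) t - ambVar R (S.quiver.out h) s
          + algebraMap R (AmbField I R) (S.weight.arrow h * S.t₁))) *
      ∏ s ∈ A (S.quiver.inc h), ∏ t ∈ B (S.quiver.out h),
        (ambVar R (S.quiver.out h) t - ambVar R (S.quiver.inc h) s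
          + algebraMap R (AmbField I R) (S.weight.opArrow h * S.t₂)))

lemma ambFac_left {A B : I → Finset ℕ} (D : I → Finset ℕ) (h : ∀ i, A i ⊆ B i) :
    ambFac S B D = ambFac S A D * ambFac S (B \ A) D := by
  unfold ambFac
  have hs : (∑ h : S.quiver.Arrow, (B (S.quiver.inc h)).card * (D (S.quiver.out h)).card) =
      (∑ h : S.quiver.Arrow, (A (S.quiver.inc h)).card * (D (S.quiver.out h)).card) +
      ∑ h : S.quiver.Arrow, ((B \ A) (S.quiver.inc h)).card * (D (S.quiver.out h)).card := by
    rw [← Finset.sum_add_distrib]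
    refine Finset.sum_congr rfl fun a _ => ?_
    rw [← add_mul, Pi.sdiff_apply, add_comm, Finset.card_sdiff_add_card_eq_card (h _)]
  have hp : ∀ i (φ : ℕ → AmbField I R), ∏ s ∈ B i, φ s =
      (∏ s ∈ A i, φ s) * ∏ s ∈ (B \ A) i, φ s := by
    intro i φ
    rw [mul_comm, Pi.sdiff_apply, Finset.prod_sdiff (h i)]
  rw [hs, pow_add]
  simp only [hp, Finset.prod_mul_distrib]
  ring

lemma ambFac_right {A B : I → Finset ℕ} (D : I → Finset ℕ) (h : ∀ i, A i ⊆ B i) :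
    ambFac S D B = ambFac S D A * ambFac S D (B \ A) := by
  unfold ambFac
  have hs : (∑ h : S.quiver.Arrow, (D (S.quiver.inc h)).card * (B (S.quiver.out h)).card) =
      (∑ h : S.quiver.Arrow, (D (S.quiver.inc h)).card * (A (S.quiver.out h)).card) +
      ∑ h : S.quiver.Arrow, (D (S.quiver.inc h)).card * ((B \ A) (S.quiver.out h)).card := by
    rw [← Finset.sum_add_distrib]
    refine Finset.sum_congr rfl fun a _ => ?_
    rw [← mul_add, Pi.sdiff_apply, add_comm, Finset.card_sdiff_add_card_eq_card (h _)]
  have hp : ∀ i (φ : ℕ → AmbField I R), ∏ s ∈ B i, φ s =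
      (∏ s ∈ A i, φ s) * ∏ s ∈ (B \ A) i, φ s := by
    intro i φ
    rw [mul_comm, Pi.sdiff_apply, Finset.prod_sdiff (h i)]
  rw [hs, pow_add]
  simp only [hp, Finset.prod_mul_distrib]
  ring

open Classical in
/-- The product of functions on coloured finite sets. -/
def ambMul (F G : (I → Finset ℕ) → AmbField I R) (C : I → Finset ℕ) : AmbField I R :=
  ∑ A ∈ Fintype.piFinset fun i => (C i).powerset, F A * G (C \ A) * ambFac S A (C \ A)

lemma ambMul_assoc (F G H : (I → Finset ℕ) → AmbField I R) :
    ambMul S (ambMul S F G) H = ambMul S F (ambMul S G H) := by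
  classical
  funext C
  unfold ambMul
  simp only [Finset.sum_mul, Finset.mul_sum]
  rw [Finset.sum_sigma', Finset.sum_sigma']
  refine Finset.sum_bij' (fun p _ => ⟨p.2, p.1 \ p.2⟩) (fun p _ => ⟨fun i => p.1 i ∪ p.2 i, p.1⟩)
    ?_ ?_ ?_ ?_ ?_
  · rintro ⟨B, A⟩ h
    simp only [Finset.mem_sigma, Fintype.mem_piFinset, Finset.mem_powerset, Pi.sdiff_apply] at h ⊢
    exact ⟨fun i => (h.2 i).trans (h.1 i), fun i => Finset.sdiff_subset_sdiff (h.1 i) le_rfl⟩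
  · rintro ⟨A, B⟩ h
    simp only [Finset.mem_sigma, Fintype.mem_piFinset, Finset.mem_powerset, Pi.sdiff_apply] at h ⊢
    refine ⟨fun i => Finset.union_subset (h.1 i) ((h.2 i).trans Finset.sdiff_subset), fun i => ?_⟩
    exact Finset.subset_union_left
  · rintro ⟨B, A⟩ h
    simp only [Finset.mem_sigma, Fintype.mem_piFinset, Finset.mem_powerset] at h
    have : (fun i => A i ∪ (B \ A) i) = B := by
      funext i
      exact Finset.union_sdiff_of_subset (h.2 i)
    simp only [this]
  · rintro ⟨A, B⟩ h
    simp only [Finset.mem_sigma, Fintype.mem_piFinset, Finset.mem_powerset, Pi.sdiff_apply] at h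
    have : (fun i => A i ∪ B i) \ A = B := by
      funext i
      ext a
      have := fun ha : a ∈ B i => h.2 i ha
      simp only [Finset.mem_sdiff] at this
      change a ∈ (A i ∪ B i) \ A i ↔ _
      simp only [Finset.mem_sdiff, Finset.mem_union]
      tauto
    simp only [this]
  · rintro ⟨B, A⟩ h
    simp only [Finset.mem_sigma, Fintype.mem_piFinset, Finset.mem_powerset] at h
    have e : (C \ A) \ (B \ A) = C \ B := by
      funext i
      ext a
      change a ∈ (C i \ A i) \ (B i \ A i) ↔ a ∈ C i \ B i
      have := fun ha : a ∈ A i => h.2 i ha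
      simp only [Finset.mem_sdiff]
      tauto
    have h1 := ambFac_left S (C \ B) h.2
    have h2 := ambFac_right S (A := B \ A) (B := C \ A) A
      (fun i => Finset.sdiff_subset_sdiff (h.1 i) le_rfl)
    rw [e] at h2
    simp only [e, h1, h2]
    ring

/-- The embedding of the shuffle algebra into functions on coloured finite sets: a symmetric
polynomial of degree `v` is evaluated at the coloured sets with `v^i` elements of colour `i`. -/
def amb (a : TwistedShuffle S) (A : I → Finset ℕ) : AmbField I R :=
  aeval (fun x : Var (fun i => (A i).card) => ambVar R x.1 ((A x.1).orderEmbOfFin rfl x.2))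
    (comp S (fun i => (A i).card) a).1

lemma amb_add (a b : TwistedShuffle S) : amb S (a + b) = amb S a + amb S b := by
  funext A
  simp only [amb, map_add, Subalgebra.coe_add, Pi.add_apply]

lemma amb_zero : amb S 0 = 0 := by
  funext A
  simp only [amb, map_zero, Subalgebra.coe_zero, Pi.zero_apply]

lemma aeval_amb_injective {v : I → ℕ} (e : ∀ i, Fin (v i) → ℕ)
    (he : ∀ i, Function.Injective (e i)) :
    Function.Injective (aeval (fun x : Var v => ambVar R x.1 (e x.1 x.2)) :
      MvPolynomial (Var v) R →ₐ[R] AmbField I R) := by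
  have h : (aeval (fun x : Var v => ambVar R x.1 (e x.1 x.2)) :
      MvPolynomial (Var v) R →ₐ[R] AmbField I R) =
      (IsScalarTower.toAlgHom R (MvPolynomial (I × ℕ) R) (AmbField I R)).comp
        (rename fun x => (x.1, e x.1 x.2)) := by
    apply MvPolynomial.algHom_ext
    intro x
    simp [ambVar]
  rw [h]
  refine (IsFractionRing.injective (MvPolynomial (I × ℕ) R) (AmbField I R)).comp
    (rename_injective _ ?_)
  rintro ⟨i, s⟩ ⟨j, t⟩ hst
  simp only [Prod.mk.injEq] at hst
  obtain ⟨rfl, hst⟩ := hst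
  exact congrArg _ (he i hst)

lemma amb_injective : Function.Injective (amb S) := by
  intro a b hab
  apply ext_comp
  intro v
  obtain ⟨A, rfl⟩ : ∃ A : I → Finset ℕ, v = fun i => (A i).card :=
    ⟨fun i => Finset.range (v i), by simp⟩
  have h := congrFun hab A
  unfold amb at h
  have hi := aeval_amb_injective (R := R) (fun i => ((A i).orderEmbOfFin rfl : _ → ℕ))
    (fun i => RelEmbedding.injective _)
  exact Subtype.ext (hi h)

lemma amb_of (f : SHDeg R v) (A : I → Finset ℕ) (h : ∀ i, (A i).card = v i) :
    amb S (of S v f) A =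
      aeval (fun x : Var v => ambVar R x.1 ((A x.1).orderEmbOfFin (h x.1) x.2)) f.1 := by
  obtain rfl : v = fun i => (A i).card := funext fun i => (h i).symm
  rw [amb, comp_of_same]

lemma amb_of_ne (f : SHDeg R v) (A : I → Finset ℕ) (h : ¬ ∀ i, (A i).card = v i) :
    amb S (of S v f) A = 0 := by
  rw [amb, comp_of_ne]
  · simp
  · intro e
    exact h (congrFun e)

lemma prod_orderEmb {M : Type*} [CommMonoid M] (A : Finset ℕ) {n : ℕ} (h : A.card = n)
    (φ : ℕ → M) : ∏ s : Fin n, φ (A.orderEmbOfFin h s) = ∏ s ∈ A, φ s := by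
  conv_rhs => rw [← Finset.map_orderEmbOfFin_univ A h, Finset.prod_map]
  rfl

variable [CharZero R]

lemma amb_twistedProduct (f : SHDeg R v₁) (g : SHDeg R v₂) :
    amb S (of S (v₁ + v₂) (twistedProduct S f g)) =
      ambMul S (amb S (of S v₁ f)) (amb S (of S v₂ g)) := by
  classical
  funext C
  by_cases hC : ∀ i, (C i).card = (v₁ + v₂) i
  · have hinj := aeval_amb_injective (R := R) (v := v₁ + v₂)
      (fun i => ((C i).orderEmbOfFin (hC i) : _ → ℕ)) (fun i => RelEmbedding.injective _)
    rw [amb_of S _ C hC, twistedProduct, Subalgebra.coe_smul, map_smul,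
      aeval_shuffleProduct S f g _ hinj, shuffleSum_eq, ambMul, Finset.smul_sum]
    let im : Sub v₁ v₂ → I → Finset ℕ := fun B i =>
      (B.1 i).map ((C i).orderEmbOfFin (hC i)).toEmbedding
    have himc : ∀ B i, (im B i).card = v₁ i := fun B i => by
      rw [Finset.card_map, B.2 i]
    have himsub : ∀ B i, im B i ⊆ C i := fun B i a ha => by
      obtain ⟨b, _, rfl⟩ := Finset.mem_map.1 ha
      exact Finset.orderEmbOfFin_mem _ _ _
    have himd : ∀ B i, ((C \ im B) i).card = v₂ i := fun B i => by
      rw [Pi.sdiff_apply, Finset.card_sdiff_of_subset (himsub B i), hC, himc, Pi.add_apply,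
        Nat.add_sub_cancel_left]
    refine Finset.sum_of_injOn im ?_ ?_ ?_ ?_
    · intro B _ B' _ h
      apply Subtype.ext
      funext i
      exact Finset.map_injective _ (congrFun h i)
    · intro B _
      simp only [Finset.mem_coe, Fintype.mem_piFinset, Finset.mem_powerset]
      exact himsub B
    · intro A hA hA'
      simp only [Fintype.mem_piFinset, Finset.mem_powerset] at hA
      rw [amb_of_ne S f A, zero_mul, zero_mul]
      intro hcard
      apply hA'
      have hpre : ∀ i, ((Finset.univ.filter fun s => (C i).orderEmbOfFin (hC i) s ∈ A i).map
          ((C i).orderEmbOfFin (hC i)).toEmbedding) = A i := by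
        intro i
        ext a
        simp only [Finset.mem_map, Finset.mem_filter, Finset.mem_univ, true_and]
        constructor
        · rintro ⟨s, hs, rfl⟩
          exact hs
        · intro ha
          have : a ∈ Set.range ((C i).orderEmbOfFin (hC i)) := by
            rw [Finset.range_orderEmbOfFin]
            exact hA i ha
          obtain ⟨s, rfl⟩ := this
          exact ⟨s, ha, rfl⟩
      refine ⟨⟨fun i => Finset.univ.filter fun s => (C i).orderEmbOfFin (hC i) s ∈ A i,
        fun i => ?_⟩, Finset.mem_coe.2 (Finset.mem_univ _), funext hpre⟩
      rw [← hcard i]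
      conv_rhs => rw [← hpre i, Finset.card_map]
    · intro B _
      have hl : ∀ a : Var v₁, (C (B.left a).1).orderEmbOfFin (hC _) (B.left a).2 =
          (im B a.1).orderEmbOfFin (himc B a.1) a.2 := by
        rintro ⟨i, s⟩
        refine congrFun (Finset.orderEmbOfFin_unique (himc B i)
          (f := fun s => (C i).orderEmbOfFin (hC i) ((B.1 i).orderEmbOfFin (B.2 i) s))
          (fun s => ?_) ?_) s
        · exact Finset.mem_map_of_mem _ (Finset.orderEmbOfFin_mem _ _ _)
        · exact ((C i).orderEmbOfFin (hC i)).strictMono.comp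
            ((B.1 i).orderEmbOfFin (B.2 i)).strictMono
      have hr : ∀ a : Var v₂, (C (B.right a).1).orderEmbOfFin (hC _) (B.right a).2 =
          ((C \ im B) a.1).orderEmbOfFin (himd B a.1) a.2 := by
        rintro ⟨i, s⟩
        refine congrFun (Finset.orderEmbOfFin_unique (himd B i)
          (f := fun s => (C i).orderEmbOfFin (hC i)
            ((B.1 i)ᶜ.orderEmbOfFin (B.card_compl i) s))
          (fun s => ?_) ?_) s
        · rw [Pi.sdiff_apply, Finset.mem_sdiff]
          refine ⟨Finset.orderEmbOfFin_mem _ _ _, fun hm => ?_⟩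
          obtain ⟨b, hb, e⟩ := Finset.mem_map.1 hm
          have e := RelEmbedding.injective _ e
          have h2 := Finset.orderEmbOfFin_mem (B.1 i)ᶜ (B.card_compl i) s
          rw [← e, Finset.mem_compl] at h2
          exact h2 hb
        · exact ((C i).orderEmbOfFin (hC i)).strictMono.comp
            ((B.1 i)ᶜ.orderEmbOfFin (B.card_compl i)).strictMono
      rw [amb_of S f _ (himc B), amb_of S g _ (himd B)]
      unfold subTerm
      simp only [hl, hr]
      have hl1 : ∀ a, (B.left a).1 = a.1 := fun _ => rfl
      have hr1 : ∀ a, (B.right a).1 = a.1 := fun _ => rfl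
      simp only [hl1, hr1]
      have hf1 : fac₁ S
          (fun a : Var v₁ => ambVar R a.1 ((im B a.1).orderEmbOfFin (himc B a.1) a.2))
          (fun a : Var v₂ => ambVar R a.1 (((C \ im B) a.1).orderEmbOfFin (himd B a.1) a.2)) =
          ∏ i, ∏ s ∈ im B i, ∏ t ∈ (C \ im B) i,
          (ambVar R i t - ambVar R i s + algebraMap R (AmbField I R) (S.weight.vertex i * S.t₃)) /
            (ambVar R i t - ambVar R i s) := by
        unfold fac₁
        refine Finset.prod_congr rfl fun i _ => ?_
        rw [← prod_orderEmb (im B i) (himc B i)]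
        refine Finset.prod_congr rfl fun s _ => ?_
        rw [← prod_orderEmb ((C \ im B) i) (himd B i)]
      have hf2 : fac₂ S
          (fun a : Var v₁ => ambVar R a.1 ((im B a.1).orderEmbOfFin (himc B a.1) a.2))
          (fun a : Var v₂ => ambVar R a.1 (((C \ im B) a.1).orderEmbOfFin (himd B a.1) a.2)) =
          ∏ h : S.quiver.Arrow,
          ((∏ s ∈ im B (S.quiver.out h), ∏ t ∈ (C \ im B) (S.quiver.inc h),
              (ambVar R (S.quiver.inc h) t - ambVar R (S.quiver.out h) s
                + algebraMap R (AmbField I R) (S.weight.arrow h * S.t₁))) *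
            ∏ s ∈ im B (S.quiver.inc h), ∏ t ∈ (C \ im B) (S.quiver.out h),
              (ambVar R (S.quiver.out h) t - ambVar R (S.quiver.inc h) s
                + algebraMap R (AmbField I R) (S.weight.opArrow h * S.t₂))) := by
        unfold fac₂
        refine Finset.prod_congr rfl fun h _ => ?_
        congr 1
        · rw [← prod_orderEmb (im B _) (himc B _)]
          refine Finset.prod_congr rfl fun s _ => ?_
          rw [← prod_orderEmb ((C \ im B) _) (himd B _)]
        · rw [← prod_orderEmb (im B _) (himc B _)]
          refine Finset.prod_congr rfl fun s _ => ?_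
          rw [← prod_orderEmb ((C \ im B) _) (himd B _)]
      rw [hf1, hf2]
      unfold ambFac
      simp only [himc, himd]
      rw [Algebra.smul_def, map_pow, map_neg, map_one, signExp]
      ring
  · rw [amb_of_ne S _ C hC, ambMul]
    symm
    refine Finset.sum_eq_zero fun A hA => ?_
    simp only [Fintype.mem_piFinset, Finset.mem_powerset] at hA
    by_cases h1 : ∀ i, (A i).card = v₁ i
    · rw [amb_of_ne S g, mul_zero, zero_mul]
      intro h2
      apply hC
      intro i
      rw [Pi.add_apply, ← h1 i, ← h2 i, Pi.sdiff_apply, add_comm,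
        Finset.card_sdiff_add_card_eq_card (hA i)]
    · rw [amb_of_ne S f A h1, zero_mul, zero_mul]

end Ambient

variable [IsDomain R] [CharZero R]

/-- The sign-twisted shuffle product `⋆` on `⨁_v SH_v`. -/
def mulHom : TwistedShuffle S →ₗ[R] TwistedShuffle S →ₗ[R] TwistedShuffle S :=
  lift S fun v₁ => LinearMap.flip (lift S fun v₂ =>
    LinearMap.flip ((twistedBilin S v₁ v₂).compr₂ (of S (v₁ + v₂))))

lemma mulHom_of (f : SHDeg R v₁) (g : SHDeg R v₂) :
    mulHom S (of S v₁ f) (of S v₂ g) = of S (v₁ + v₂) (twistedProduct S f g) := by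
  rw [mulHom, lift_of, LinearMap.flip_apply, lift_of]
  rfl

lemma amb_mulHom (a b : TwistedShuffle S) :
    amb S (mulHom S a b) = ambMul S (amb S a) (amb S b) := by
  induction a using induction_on with
  | h0 =>
    rw [map_zero, LinearMap.zero_apply, amb_zero]
    funext C
    simp [ambMul]
  | hadd a a' ha ha' =>
    rw [map_add, LinearMap.add_apply, amb_add, amb_add, ha, ha']
    funext C
    simp [ambMul, add_mul, Finset.sum_add_distrib]
  | hof v f =>
    induction b using induction_on with
    | h0 =>
      rw [map_zero, amb_zero]
      funext C
      simp [ambMul]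
    | hadd b b' hb hb' =>
      rw [map_add, amb_add, amb_add, hb, hb']
      funext C
      simp [ambMul, add_mul, mul_add, Finset.sum_add_distrib]
    | hof w g => rw [mulHom_of, amb_twistedProduct]

lemma amb_one (A : I → Finset ℕ) [Decidable (A = fun _ => ∅)] :
    amb S (of S 0 1) A = if A = (fun _ => ∅) then 1 else 0 := by
  split_ifs with h
  · subst h
    rw [amb_of S (v := 0) 1 (fun _ => ∅) (fun i => rfl)]
    simp
  · apply amb_of_ne
    intro h1
    apply h
    funext i
    exact Finset.card_eq_zero.1 (h1 i)

lemma one_mulHom (a : TwistedShuffle S) : mulHom S (of S 0 1) a = a := by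
  classical
  apply amb_injective S
  rw [amb_mulHom]
  funext C
  rw [ambMul, Finset.sum_eq_single (fun _ => ∅)]
  · have : (C \ fun _ => (∅ : Finset ℕ)) = C := by
      funext i
      exact Finset.sdiff_empty
    rw [amb_one, if_pos rfl, this, one_mul]
    simp [ambFac]
  · intro A _ hA
    rw [amb_one, if_neg hA, zero_mul, zero_mul]
  · intro h
    simp at h

lemma mulHom_one (a : TwistedShuffle S) : mulHom S a (of S 0 1) = a := by
  classical
  apply amb_injective S
  rw [amb_mulHom]
  funext C
  rw [ambMul, Finset.sum_eq_single C]
  · have : C \ C = (fun _ => (∅ : Finset ℕ)) := by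
      funext i
      exact Finset.sdiff_self _
    rw [amb_one, this, if_pos rfl, mul_one]
    simp [ambFac]
  · intro A hA hAC
    rw [amb_one, if_neg, mul_zero, zero_mul]
    intro h
    apply hAC
    simp only [Fintype.mem_piFinset, Finset.mem_powerset] at hA
    funext i
    exact Finset.Subset.antisymm (hA i) (Finset.sdiff_eq_empty_iff_subset.1 (congrFun h i))
  · intro h
    simp at h

/-- The sign-twisted shuffle algebra is an associative unital ring. -/
instance : Ring (TwistedShuffle S) :=
  { (inferInstance : AddCommGroup (TwistedShuffle S)) with
    mul := fun a b => mulHom S a b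
    one := of S 0 1
    mul_assoc := fun a b c => amb_injective S (by
      change amb S (mulHom S (mulHom S a b) c) = amb S (mulHom S a (mulHom S b c))
      rw [amb_mulHom, amb_mulHom, amb_mulHom, amb_mulHom, ambMul_assoc])
    one_mul := one_mulHom S
    mul_one := mulHom_one S
    left_distrib := fun a b c => map_add (mulHom S a) b c
    right_distrib := fun a b c => LinearMap.map_add₂ (mulHom S) a b c
    zero_mul := fun a => LinearMap.map_zero₂ (mulHom S) a
    mul_zero := fun a => map_zero (mulHom S a) }

instance : Algebra R (TwistedShuffle S) :=
  Algebra.ofModule (fun r a b => LinearMap.map_smul₂ (mulHom S) r a b)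
    (fun r a b => map_smul (mulHom S a) r b)

lemma of_mul_of (f : SHDeg R v₁) (g : SHDeg R v₂) :
    of S v₁ f * of S v₂ g = of S (v₁ + v₂) (twistedProduct S f g) :=
  mulHom_of S f g

end TwistedShuffle

namespace TwistedShuffle

/-- The element `(λ^{(k)})^r` of `SH_{e_k} = R[λ^{(k)}]`. -/
def lamPow {I : Type*} [DecidableEq I] (R : Type*) [CommRing R] (k : I) (r : ℕ) :
    SHDeg R (Pi.single k 1 : I → ℕ) :=
  ⟨X ⟨k, ⟨0, by simp⟩⟩ ^ r, fun σ => by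
    have : Subsingleton (Var (Pi.single k 1 : I → ℕ)) := by
      have h : ∀ (i : I) (s : Fin ((Pi.single k 1 : I → ℕ) i)), i = k ∧ s.1 = 0 := by
        intro i s
        by_cases hi : i = k
        · subst hi
          have := s.2.trans_eq (Pi.single_eq_same i 1)
          exact ⟨rfl, by omega⟩
        · have := s.2.trans_eq (Pi.single_eq_of_ne hi 1)
          omega
      refine ⟨?_⟩
      rintro ⟨i, s⟩ ⟨j, t⟩
      obtain ⟨rfl, hs⟩ := h i s
      obtain ⟨rfl, ht⟩ := h j t
      exact congrArg (Sigma.mk j) (Fin.ext (hs.trans ht.symm))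
    rw [map_pow, rename_X]
    congr 2
    exact Subsingleton.elim _ _⟩

/-- A shuffle algebra over `ℂ[ħ]` is in particular a `ℚ[ħ]`-algebra. -/
instance {I : Type*} [Fintype I] (S : ShuffleDatum I (Polynomial ℂ)) :
    Algebra (Polynomial ℚ) (TwistedShuffle S) :=
  Algebra.compHom (TwistedShuffle S) (Polynomial.mapRingHom (algebraMap ℚ ℂ))

end TwistedShuffle

/-! ### Cartan matrices with symmetrizer -/

section Cartan

variable {n : ℕ} (A : Matrix (Fin n) (Fin n) ℤ) (d : Fin n → ℕ)

/-- `A` is a symmetrizable generalized Cartan matrix with symmetrizer `D = diag(d₁, …, dₙ)`. -/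
structure IsCartanWithSymmetrizer : Prop where
  diag : ∀ i, A i i = 2
  nonpos : ∀ i j, i ≠ j → A i j ≤ 0
  ne_zero_iff : ∀ i j, A i j ≠ 0 ↔ A j i ≠ 0
  pos : ∀ i, 0 < d i
  symm : ∀ i j, (d i : ℤ) * A i j = d j * A j i

/-- The quiver with symmetrizer of `(A, D)`: for `i < j` there are `gcd(a_{ij}, a_{ji})` arrows from
`i` to `j`, and `l_{ij} = |a_{ij} / gcd(a_{ij}, a_{ji})|`. -/
def cartanQuiver : QuiverWithSymmetrizer (Fin n) where
  Arrow := Σ p : {p : Fin n × Fin n // p.1 < p.2}, Fin (Int.gcd (A p.1.1 p.1.2) (A p.1.2 p.1.1))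
  out h := h.1.1.1
  inc h := h.1.1.2
  l i j := (A i j / (Int.gcd (A i j) (A j i) : ℤ)).natAbs

/-- The weights `𝐦_i = d_i`, `𝐦_{h_p} = (m + 2 - 2p) e`, `𝐦_{h_p^*} = (-m + 2p) e` where
`h_1, …, h_m` are the arrows from `i` to `j` and `e = 𝐦_i l_{ij} = 𝐦_j l_{ji}`. The arrow `h_p` is
the pair `⟨(i, j), p - 1⟩`. -/
def cartanWeight : WeightFunction (cartanQuiver A) where
  vertex i := d i
  arrow h := ((Int.gcd (A h.1.1.1 h.1.1.2) (A h.1.1.2 h.1.1.1) : ℤ) + 2 - 2 * ((h.2 : ℕ) + 1)) *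
    (d h.1.1.1 * (cartanQuiver A).l h.1.1.1 h.1.1.2)
  opArrow h := (-(Int.gcd (A h.1.1.1 h.1.1.2) (A h.1.1.2 h.1.1.1) : ℤ) + 2 * ((h.2 : ℕ) + 1)) *
    (d h.1.1.1 * (cartanQuiver A).l h.1.1.1 h.1.1.2)

/-- The quiver and weights of `(A, D)` with the specialization `t₁ = t₂ = ħ/2`, `t₃ = -ħ` in
`ℂ[ħ]`. -/
def cartanDatum : ShuffleDatum (Fin n) (Polynomial ℂ) where
  quiver := cartanQuiver A
  weight := cartanWeight A d
  t₁ := Polynomial.C (1 / 2) * Polynomial.X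
  t₂ := Polynomial.C (1 / 2) * Polynomial.X
  t₃ := -Polynomial.X

/-- The sign-twisted shuffle algebra of `(A, D)` specialized at `t₁ = t₂ = ħ/2`, `t₃ = -ħ`. -/
abbrev CartanShuffle : Type := TwistedShuffle (cartanDatum A d)

/-- The generator `x_{k,r}` in the free `ℚ[ħ]`-algebra. -/
def freeGen (n : ℕ) (k : Fin n) (r : ℕ) : FreeAlgebra (Polynomial ℚ) (Fin n × ℕ) :=
  FreeAlgebra.ι (Polynomial ℚ) (k, r)

/-- The scalar `d_k a_{kl} ħ / 2`. -/
def yangianScalar (k l : Fin n) : Polynomial ℚ :=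
  Polynomial.C ((d k * A k l : ℚ) / 2) * Polynomial.X

/-- The defining relations of the positive Yangian, written for the modes `x_{k,r}`: the relation
`quadratic` is the coefficient of `u^{-r-1} v^{-s-1}` of the quadratic relation between the
generating series `∑_r x_{k,r} u^{-r-1}` and `∑_s x_{l,s} v^{-s-1}` (the coefficients of
`u^0 v^{-s-1}` and `u^{-r-1} v^0` of that relation are trivial), and `serre` is the coefficient of
`u_1^{-r_1-1} ⋯ u_N^{-r_N-1} v^{-s-1}`, `N = 1 - a_{kl}`, of the Serre relation. -/
inductive YangianRel : FreeAlgebra (Polynomial ℚ) (Fin n × ℕ) →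
    FreeAlgebra (Polynomial ℚ) (Fin n × ℕ) → Prop
  | quadratic (k l : Fin n) (r s : ℕ) : YangianRel
      (freeGen n k (r + 1) * freeGen n l s - freeGen n k r * freeGen n l (s + 1)
        - yangianScalar A d k l • (freeGen n k r * freeGen n l s))
      (freeGen n l s * freeGen n k (r + 1) - freeGen n l (s + 1) * freeGen n k r
        + yangianScalar A d k l • (freeGen n l s * freeGen n k r))
  | serre (k l : Fin n) (hkl : k ≠ l) (r : Fin (1 - A k l).toNat → ℕ) (s : ℕ) : YangianRel
      (∑ σ : Equiv.Perm (Fin (1 - A k l).toNat),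
        (List.ofFn fun p => freeGen n k (r (σ p))).foldr (fun a b => a * b - b * a)
          (freeGen n l s))
      0

/-- The positive part `Y⁺_ħ(𝔤_{A,D})` of the Yangian, over `ℚ[ħ]`. -/
abbrev PositiveYangian : Type := RingQuot (YangianRel A d)

/-- The generator `x⁺_{k,r}` of the positive Yangian. -/
def PositiveYangian.x (k : Fin n) (r : ℕ) : PositiveYangian A d :=
  RingQuot.mkAlgHom (Polynomial ℚ) (YangianRel A d) (freeGen n k r)

end Cartan

end

end ShuffleYangian

open ShuffleYangian

/-!
An element of the shuffle algebra determines a function on finite coloured sets of variables with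
values in a field of rational functions, and the product becomes a sum over splittings of the set.
For one point of colour `k` and one of colour `l`, with difference of variables `z`, let `F` and `G`
be the factors of the product in the two orders. The quadratic relation with parameter `c` amounts
to `(z - c) F = (z + c) G`. It holds because the weights of the arrows between two vertices form an
arithmetic progression, so that the quotient of `F` and `G` telescopes.

By polarization over the sums `x` of the `x_{k,r}`, the Serre relation follows from
`(ad x)^N y = 0` for `x` of degree `e_k` and `y` of degree `e_l`. By the quadratic relation, `F` and
`G` differ only in a linear factor, and the factors among points of colour `k` are products of
`(z ± η) / z`. The commutator with `x` is therefore a sum which Lagrange interpolation evaluates,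
showing that the `(j + 1)`-st commutator multiplies by a scalar divisible by `-2 c - j η`. Since
`2 c = a_{kl} η`, the last commutator, with `j = -a_{kl}`, gives zero.
-/

namespace ShuffleYangian

noncomputable section

section LagrangeSums

theorem coeff_taylor_eq_sum {R : Type*} [CommSemiring R] {f : Polynomial R} {n : ℕ}
    (hf : f.natDegree ≤ n) (h : R) (m : ℕ) :
    (f.taylor h).coeff m =
      ∑ i ∈ Finset.range (n - m + 1), ((i + m).choose m : R) * f.coeff (i + m) * h ^ i := by
  have hdeg : (f.hasseDeriv m).natDegree < n - m + 1 :=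
    Nat.lt_succ_of_le
      ((Polynomial.natDegree_hasseDeriv_le f m).trans (Nat.sub_le_sub_right hf m))
  simp only [Polynomial.taylor_coeff, Polynomial.eval_eq_sum_range' hdeg,
    Polynomial.hasseDeriv_coeff]

theorem coeff_taylor_sub_self {R : Type*} [CommRing R] {f : Polynomial R} {n : ℕ}
    (hf : f.natDegree ≤ n + 1) (h : R) :
    (f.taylor h - f).coeff n = (n + 1) * h * f.coeff (n + 1) := by
  rw [Polynomial.coeff_sub, coeff_taylor_eq_sum hf, Nat.add_sub_cancel_left]
  simp only [Nat.reduceAdd, Finset.sum_range_succ, Finset.range_one, Finset.sum_singleton, zero_add,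
    Nat.choose_self, Nat.cast_one, one_mul, pow_zero, mul_one, add_comm 1 n,
    Nat.choose_succ_self_right, Nat.cast_add, pow_one, add_sub_cancel_left]
  ring

theorem coeff_taylor_sub_self_of_natDegree_le_add_two {R : Type*} [CommRing R] {f : Polynomial R}
    {n : ℕ} (hf : f.natDegree ≤ n + 2) (h : R) :
    (f.taylor h - f).coeff n =
      (n + 1) * h * f.coeff (n + 1) + (n + 2).choose 2 * h ^ 2 * f.coeff (n + 2) := by
  rw [Polynomial.coeff_sub, coeff_taylor_eq_sum hf, Nat.add_sub_cancel_left]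
  simp only [Nat.reduceAdd, Finset.sum_range_succ, Finset.range_one, Finset.sum_singleton, zero_add,
    Nat.choose_self, Nat.cast_one, one_mul, pow_zero, mul_one, add_comm 1 n,
    Nat.choose_succ_self_right, Nat.cast_add, pow_one, add_comm 2 n,
    Nat.choose_symm_add (a := n) (b := 2)]
  ring

section Nodal

variable {R ι : Type*} [CommRing R] {s : Finset ι} {v : ι → R} {n : ℕ}

theorem coeff_nodal_of_card_eq_add_one (hn : s.card = n + 1) :
    (Lagrange.nodal s v).coeff n = -∑ i ∈ s, v i := by
  have := Polynomial.prod_X_sub_C_coeff_card_pred s v (by omega)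
  rwa [hn, Nat.add_sub_cancel] at this

variable [Nontrivial R]

theorem coeff_nodal_of_card_eq (hn : s.card = n) : (Lagrange.nodal s v).coeff n = 1 := by
  rw [← hn, ← Lagrange.natDegree_nodal (v := v)]
  exact Lagrange.nodal_monic.coeff_natDegree

theorem natDegree_taylor_nodal_sub_nodal_le (hn : s.card = n + 1) (h : R) :
    ((Lagrange.nodal s v).taylor h - Lagrange.nodal s v).natDegree ≤ n := by
  have hlt := Polynomial.degree_sub_lt_left (Polynomial.degree_taylor (Lagrange.nodal s v) h)
    (by simpa using Lagrange.nodal_ne_zero) (Polynomial.leadingCoeff_taylor h _)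
  rw [Polynomial.degree_taylor, Lagrange.degree_nodal, hn,
    Polynomial.degree_lt_iff_coeff_zero] at hlt
  exact Polynomial.natDegree_le_iff_coeff_eq_zero.2 hlt

theorem coeff_taylor_nodal_sub_nodal_of_card_eq_add_one (hn : s.card = n + 1) (h : R) :
    ((Lagrange.nodal s v).taylor h - Lagrange.nodal s v).coeff n = s.card * h := by
  rw [coeff_taylor_sub_self (Lagrange.natDegree_nodal.trans hn).le, coeff_nodal_of_card_eq hn,
    mul_one, hn, Nat.cast_add_one]

theorem coeff_C_sub_X_mul_taylor_nodal_sub_nodal (hn : s.card = n + 1) (a h : R) :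
    ((Polynomial.C a - Polynomial.X) *
      ((Lagrange.nodal s v).taylor h - Lagrange.nodal s v)).coeff n =
      h * (s.card * a + (s.card - 1) * ∑ i ∈ s, v i - s.card.choose 2 * h) := by
  rw [sub_mul, Polynomial.coeff_sub, Polynomial.coeff_C_mul,
    coeff_taylor_nodal_sub_nodal_of_card_eq_add_one hn, hn]
  obtain _ | n := n
  · simp [mul_comm]
  · rw [Polynomial.coeff_X_mul, coeff_taylor_sub_self_of_natDegree_le_add_two
      (Lagrange.natDegree_nodal.trans hn).le, coeff_nodal_of_card_eq hn,
      coeff_nodal_of_card_eq_add_one hn]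
    push_cast
    ring

end Nodal

variable {K ι : Type*} [Field K] [DecidableEq ι] {s : Finset ι} {v : ι → K}

theorem eval_taylor_nodal_sub_nodal {i : ι} (hi : i ∈ s) (h : K) :
    ((Lagrange.nodal s v).taylor h - Lagrange.nodal s v).eval (v i) =
      h * ∏ t ∈ s.erase i, (v i - v t + h) := by
  rw [Polynomial.eval_sub, Polynomial.taylor_eval, Lagrange.eval_nodal_at_node hi, sub_zero,
    Lagrange.eval_nodal, ← Finset.mul_prod_erase s _ hi, add_sub_cancel_left]
  simp only [sub_add_eq_add_sub]

theorem sum_eval_div_prod_erase_sub (hv : Set.InjOn v s) {n : ℕ} (hn : s.card = n + 1)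
    {P : Polynomial K} (hP : P.natDegree ≤ n + 1) :
    ∑ i ∈ s, P.eval (v i) / ∏ t ∈ s.erase i, (v i - v t) =
      P.coeff n + P.coeff (n + 1) * ∑ i ∈ s, v i := by
  set Q := P - Polynomial.C (P.coeff (n + 1)) * Lagrange.nodal s v with hQ
  have hdeg : Q.degree < s.card := by
    rw [hn, Polynomial.degree_lt_iff_coeff_zero]
    intro m hm
    rw [hQ, Polynomial.coeff_sub, Polynomial.coeff_C_mul]
    obtain rfl | hm := hm.eq_or_lt
    · rw [coeff_nodal_of_card_eq hn, mul_one, sub_self]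
    · rw [Polynomial.coeff_eq_zero_of_natDegree_lt (hP.trans_lt hm),
        Polynomial.coeff_eq_zero_of_natDegree_lt (p := Lagrange.nodal s v)
          (by rwa [Lagrange.natDegree_nodal, hn]), mul_zero, sub_zero]
  calc ∑ i ∈ s, P.eval (v i) / ∏ t ∈ s.erase i, (v i - v t)
      = ∑ i ∈ s, Q.eval (v i) / ∏ t ∈ s.erase i, (v i - v t) :=
        Finset.sum_congr rfl fun i hi => by
          rw [hQ, Polynomial.eval_sub, Polynomial.eval_mul, Lagrange.eval_nodal_at_node hi,
            mul_zero, sub_zero]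
    _ = Q.coeff n := by rw [← Lagrange.coeff_eq_sum hv hdeg, hn, Nat.add_sub_cancel]
    _ = P.coeff n + P.coeff (n + 1) * ∑ i ∈ s, v i := by
        rw [hQ, Polynomial.coeff_sub, Polynomial.coeff_C_mul, coeff_nodal_of_card_eq_add_one hn]
        ring

theorem prod_erase_sub_div_sub_eq_one (hv : Set.InjOn v s) {i : ι} (hi : i ∈ s) :
    ∏ t ∈ s.erase i, (v i - v t) / (v i - v t) = 1 :=
  Finset.prod_eq_one fun _ ht => div_self <| sub_ne_zero.2 fun heq =>
    Finset.ne_of_mem_erase ht (hv hi (Finset.mem_of_mem_erase ht) heq).symm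

theorem sum_prod_erase_sub_add_div_sub_mul_sub (hv : Set.InjOn v s) (h a : K) :
    ∑ i ∈ s, (∏ t ∈ s.erase i, (v i - v t + h) / (v i - v t)) * (a - v i) =
      s.card * a - ∑ i ∈ s, v i - s.card.choose 2 * h := by
  obtain rfl | hs := s.eq_empty_or_nonempty
  · simp
  obtain rfl | hh := eq_or_ne h 0
  · simp only [add_zero, mul_zero, sub_zero]
    rw [Finset.sum_congr rfl fun i hi =>
      congrArg (· * (a - v i)) (prod_erase_sub_div_sub_eq_one hv hi)]
    simp
  obtain ⟨n, hn⟩ := Nat.exists_eq_add_one.2 hs.card_pos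
  set D := (Lagrange.nodal s v).taylor h - Lagrange.nodal s v
  have hDdeg : D.natDegree ≤ n := natDegree_taylor_nodal_sub_nodal_le hn h
  have hPdeg : ((Polynomial.C a - Polynomial.X) * D).natDegree ≤ n + 1 := by
    rw [add_comm]
    exact Polynomial.natDegree_mul_le_of_le (Polynomial.natDegree_sub_le_of_le (m := 0) (n := 1)
      (Polynomial.natDegree_C a).le Polynomial.natDegree_X_le) hDdeg
  have hinterp := sum_eval_div_prod_erase_sub hv hn hPdeg
  have hcoeff : ((Polynomial.C a - Polynomial.X) * D).coeff (n + 1) = -(s.card * h) := by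
    rw [sub_mul, Polynomial.coeff_sub, Polynomial.coeff_C_mul, Polynomial.coeff_X_mul,
      coeff_taylor_nodal_sub_nodal_of_card_eq_add_one hn,
      Polynomial.coeff_eq_zero_of_natDegree_lt (Nat.lt_succ_of_le hDdeg), mul_zero, zero_sub]
  rw [coeff_C_sub_X_mul_taylor_nodal_sub_nodal hn, hcoeff] at hinterp
  calc ∑ i ∈ s, (∏ t ∈ s.erase i, (v i - v t + h) / (v i - v t)) * (a - v i)
      = h⁻¹ * ∑ i ∈ s, ((Polynomial.C a - Polynomial.X) * D).eval (v i) /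
          ∏ t ∈ s.erase i, (v i - v t) := by
        rw [Finset.mul_sum]
        refine Finset.sum_congr rfl fun i hi => ?_
        rw [Polynomial.eval_mul, eval_taylor_nodal_sub_nodal hi, Polynomial.eval_sub,
          Polynomial.eval_C, Polynomial.eval_X, Finset.prod_div_distrib]
        field_simp
    _ = s.card * a - ∑ i ∈ s, v i - s.card.choose 2 * h := by
        rw [hinterp]
        field_simp
        ring

theorem sum_lagrange_difference (hv : Set.InjOn v s) (h u M : K) :
    ∑ i ∈ s, ((∏ t ∈ s.erase i, (v i - v t + h) / (v i - v t)) * (u - v i + M) -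
      (∏ t ∈ s.erase i, (v i - v t - h) / (v i - v t)) * (u - v i - M)) =
      s.card * (2 * M - (s.card - 1) * h) := by
  have hchoose : (s.card * (s.card - 1) : K) = s.card.choose 2 * 2 := by
    obtain hs | hs := s.card.eq_zero_or_pos
    · simp [hs]
    · obtain ⟨n, hn⟩ := Nat.exists_eq_add_one.2 hs
      have := Nat.add_one_mul_choose_eq n 1
      rw [← hn, Nat.choose_one_right] at this
      have := congrArg (Nat.cast (R := K)) this
      push_cast [hn] at this ⊢
      linear_combination this
  have hplus := sum_prod_erase_sub_add_div_sub_mul_sub hv h (u + M)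
  have hminus := sum_prod_erase_sub_add_div_sub_mul_sub hv (-h) (u - M)
  simp only [← sub_eq_add_neg] at hminus
  simp only [sub_add_eq_add_sub, sub_right_comm u] at hplus hminus ⊢
  rw [Finset.sum_sub_distrib, hplus, hminus]
  linear_combination h * hchoose

end LagrangeSums

section Polarization

theorem sum_perm_eq_sum_surjective {ι M : Type*} [Fintype ι] [DecidableEq ι] [AddCommMonoid M]
    [DecidablePred fun f : ι → ι => ∀ j, ∃ i, f i = j] (F : (ι → ι) → M) :
    ∑ σ : Equiv.Perm ι, F σ = ∑ f with ∀ j, ∃ i, f i = j, F f :=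
  Finset.sum_bij (fun σ _ => σ) (by simp [Equiv.surjective _ _]) (by simp)
    (fun f hf => ⟨.ofBijective f (Finite.surjective_iff_bijective.1 (Finset.mem_filter.1 hf).2),
      Finset.mem_univ _, rfl⟩) (by simp)

variable {A : Type*} [Ring A] {n : ℕ} (a : Fin n → A)

theorem pow_sum_eq_sum_piFinset_prod_ofFn (T : Finset (Fin n)) :
    (∑ i ∈ T, a i) ^ n =
      ∑ f ∈ Fintype.piFinset fun _ : Fin n => T, (List.ofFn fun i => a (f i)).prod := by
  have := (MultilinearMap.mkPiAlgebraFin ℤ n A).map_sum_finset (fun _ j => a j) (fun _ => T)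
  simpa only [MultilinearMap.mkPiAlgebraFin_apply, List.ofFn_const, List.prod_replicate] using this

theorem sum_perm_prod_ofFn :
    ∑ σ : Equiv.Perm (Fin n), (List.ofFn fun i => a (σ i)).prod =
      ∑ T : Finset (Fin n), (-1) ^ T.card • (∑ i ∈ Tᶜ, a i) ^ n := by
  let avoiding (j : Fin n) : Finset (Fin n → Fin n) := Fintype.piFinset fun _ => {j}ᶜ
  have hsurj : ({f | ∀ j, ∃ i, f i = j} : Finset (Fin n → Fin n)) =
      Finset.univ.inf fun j => (avoiding j)ᶜ := by
    ext f
    simp [avoiding, Finset.mem_inf]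
  have havoid (T : Finset (Fin n)) : T.inf avoiding = Fintype.piFinset fun _ => Tᶜ := by
    ext f
    simp only [avoiding, Finset.mem_inf, Fintype.mem_piFinset, Finset.mem_compl,
      Finset.mem_singleton]
    exact ⟨fun h i hi => h _ hi i rfl, fun h j hj i hij => h i (hij ▸ hj)⟩
  rw [sum_perm_eq_sum_surjective fun f => (List.ofFn fun i => a (f i)).prod, hsurj,
    Finset.inclusion_exclusion_sum_inf_compl, Finset.powerset_univ]
  simp only [havoid, pow_sum_eq_sum_piFinset_prod_ofFn]

attribute [local instance] LieRing.ofAssociativeRing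

theorem sum_perm_foldr_commutator_eq_zero {y : A}
    (h : ∀ T : Finset (Fin n), (LieAlgebra.ad ℤ A (∑ i ∈ T, a i) ^ n) y = 0) :
    ∑ σ : Equiv.Perm (Fin n),
      (List.ofFn fun i => a (σ i)).foldr (fun b c => b * c - c * b) y = 0 := by
  have hfoldr (L : List A) : L.foldr (fun b c => b * c - c * b) y =
      (L.map (LieAlgebra.ad ℤ A)).prod y := by
    induction L with
    | nil => rfl
    | cons b L ih =>
      rw [List.foldr_cons, ih, List.map_cons, List.prod_cons, Module.End.mul_apply,
        LieAlgebra.ad_apply, Ring.lie_def]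
  simp only [hfoldr, List.map_ofFn, Function.comp_def]
  rw [← LinearMap.sum_apply, sum_perm_prod_ofFn fun i => LieAlgebra.ad ℤ A (a i),
    LinearMap.sum_apply]
  refine Finset.sum_eq_zero fun T _ => ?_
  rw [LinearMap.smul_apply, ← map_sum, h, smul_zero]

end Polarization

theorem mul_prod_progression_shift {K : Type*} [CommRing K] (m : ℕ) (z e : K) :
    (z - m * e) * ∏ p : Fin m, (z + (m - 2 * (p : ℕ)) * e) =
      (z + m * e) * ∏ p : Fin m, (z + (m - 2 * ((p : ℕ) + 1)) * e) := by
  rw [Fin.prod_univ_eq_prod_range (fun p => z + (m - 2 * (p : K)) * e),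
    Fin.prod_univ_eq_prod_range (fun p => z + (m - 2 * ((p : K) + 1)) * e)]
  have hlast := Finset.prod_range_succ (fun p : ℕ => z + (m - 2 * (p : K)) * e) m
  have hfirst := Finset.prod_range_succ' (fun p : ℕ => z + (m - 2 * (p : K)) * e) m
  push_cast at hfirst
  linear_combination hfirst - hlast

namespace TwistedShuffle

section AmbVar

variable {I : Type*} {R : Type*} [CommRing R] [Nontrivial R]

lemma ambVar_sub_sub_ne_zero {k l : I} {a b : ℕ} (h : (k, a) ≠ (l, b)) (c : R) :
    ambVar R k a - ambVar R l b - algebraMap R (AmbField I R) c ≠ 0 := by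
  rw [show ambVar R k a - ambVar R l b - algebraMap R (AmbField I R) c =
      algebraMap (MvPolynomial (I × ℕ) R) (AmbField I R) (X (k, a) - X (l, b) - C c) by
    rw [map_sub, map_sub, ambVar, ambVar, IsScalarTower.algebraMap_apply R
      (MvPolynomial (I × ℕ) R) (AmbField I R), MvPolynomial.algebraMap_eq],
    map_ne_zero_iff _ (IsFractionRing.injective _ _)]
  intro h0
  classical
  have heval := congrArg (eval (Pi.single (k, a) (c + 1))) h0
  simp [Pi.single_eq_of_ne h.symm] at heval

lemma ambVar_injective (k : I) : Function.Injective (ambVar R k) := by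
  intro a b hab
  by_contra h
  apply ambVar_sub_sub_ne_zero (k := k) (l := k) (a := a) (b := b)
    (fun e => h (Prod.mk_inj.1 e).2) (0 : R)
  rw [hab, sub_self, map_zero, sub_zero]

end AmbVar

section Point

variable {I : Type*} [DecidableEq I]

/-- The coloured set whose only element is `s`, of colour `k`. -/
def point (k : I) (s : ℕ) : I → Finset ℕ := Function.update (fun _ => ∅) k {s}

lemma point_self (k : I) (s : ℕ) : point k s k = {s} := Function.update_self ..

lemma point_of_ne {i k : I} (h : i ≠ k) (s : ℕ) : point k s i = ∅ := Function.update_of_ne h ..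

lemma point_injective (k : I) : Function.Injective (point k) := fun s t h =>
  Finset.singleton_injective <| by simpa only [point_self] using congrFun h k

lemma card_point (k : I) (s : ℕ) (i : I) : (point k s i).card = (Pi.single k 1 : I → ℕ) i := by
  rcases eq_or_ne i k with rfl | hi
  · rw [point_self, Pi.single_eq_same, Finset.card_singleton]
  · rw [point_of_ne hi, Pi.single_eq_of_ne hi, Finset.card_empty]

lemma exists_eq_point_of_card {k : I} {A : I → Finset ℕ}
    (h : ∀ i, (A i).card = (Pi.single k 1 : I → ℕ) i) : ∃ s, A = point k s := by
  obtain ⟨s, hs⟩ := Finset.card_eq_one.1 ((h k).trans (Pi.single_eq_same k 1))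
  refine ⟨s, funext fun i => ?_⟩
  rcases eq_or_ne i k with rfl | hi
  · rw [hs, point_self]
  · rw [point_of_ne hi, ← Finset.card_eq_zero, h i, Pi.single_eq_of_ne hi]

lemma point_subset_iff {k : I} {s : ℕ} {C : I → Finset ℕ} : (∀ i, point k s i ⊆ C i) ↔ s ∈ C k := by
  refine ⟨fun h => h k (by rw [point_self]; exact Finset.mem_singleton_self s), fun h i => ?_⟩
  rcases eq_or_ne i k with rfl | hi
  · rw [point_self]
    exact Finset.singleton_subset_iff.2 h
  · rw [point_of_ne hi]
    exact Finset.empty_subset _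

lemma sdiff_point (k : I) (s : ℕ) (C : I → Finset ℕ) :
    C \ point k s = Function.update C k ((C k).erase s) := by
  funext i
  rw [Pi.sdiff_apply]
  rcases eq_or_ne i k with rfl | hi
  · rw [point_self, Function.update_self, Finset.sdiff_singleton_eq_erase]
  · rw [point_of_ne hi, Finset.sdiff_empty, Function.update_of_ne hi]

lemma update_point_empty {k l : I} (hkl : k ≠ l) (b : ℕ) :
    Function.update (point l b) k ∅ = point l b := by
  rw [← point_of_ne hkl b, Function.update_eq_self]

lemma sdiff_point_eq_comm {k l : I} {a b : ℕ} {C : I → Finset ℕ} (ha : a ∈ C k)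
    (h : C \ point k a = point l b) : C \ point l b = point k a :=
  h ▸ sdiff_sdiff_eq_self (point_subset_iff.2 ha)

lemma ne_of_sdiff_point_eq {k l : I} {a b : ℕ} {C : I → Finset ℕ}
    (h : C \ point k a = point l b) : (k, a) ≠ (l, b) := by
  rintro ⟨⟩
  have ha : a ∈ (C \ point k a) k := by rw [h, point_self]; exact Finset.mem_singleton_self a
  rw [Pi.sdiff_apply, point_self] at ha
  exact Finset.notMem_sdiff_of_mem_right (Finset.mem_singleton_self a) ha

lemma prod_point {M : Type*} [CommMonoid M] (k i : I) (s : ℕ) (φ : ℕ → M) :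
    ∏ t ∈ point k s i, φ t = if i = k then φ s else 1 := by
  rcases eq_or_ne i k with rfl | hi
  · rw [point_self, Finset.prod_singleton, if_pos rfl]
  · rw [point_of_ne hi, Finset.prod_empty, if_neg hi]

end Point

variable {I : Type*} [Fintype I] {R : Type*} [CommRing R] [IsDomain R]

section Amb

variable [CharZero R] (S : ShuffleDatum I R)

lemma amb_mul (a b : TwistedShuffle S) : amb S (a * b) = ambMul S (amb S a) (amb S b) :=
  amb_mulHom S a b

lemma amb_smul (c : R) (a : TwistedShuffle S) : amb S (c • a) = c • amb S a := by
  funext A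
  simp only [amb, map_smul, Subalgebra.coe_smul, Pi.smul_apply]

lemma amb_sub (a b : TwistedShuffle S) : amb S (a - b) = amb S a - amb S b := by
  rw [sub_eq_add_neg, amb_add, ← neg_one_smul R b, amb_smul, neg_one_smul, sub_eq_add_neg]

end Amb

variable [DecidableEq I]

section DegreeOne

variable {S : ShuffleDatum I R} {k l : I} (f : SHDeg R (Pi.single k 1 : I → ℕ))
  (g : SHDeg R (Pi.single l 1 : I → ℕ))

lemma amb_of_single_eq_zero {A : I → Finset ℕ} (hA : ∀ s, A ≠ point k s) :
    amb S (of S (Pi.single k 1) f) A = 0 := by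
  refine amb_of_ne S _ _ fun h => ?_
  obtain ⟨s, hs⟩ := exists_eq_point_of_card h
  exact hA s hs

variable [CharZero R]

lemma amb_of_single_mul (y : TwistedShuffle S) (C : I → Finset ℕ) :
    amb S (of S (Pi.single k 1) f * y) C =
      ∑ s ∈ C k, amb S (of S (Pi.single k 1) f) (point k s) * amb S y (C \ point k s) *
        ambFac S (point k s) (C \ point k s) := by
  classical
  rw [amb_mul, ambMul]
  symm
  refine Finset.sum_of_injOn (point k) (point_injective k).injOn ?_ ?_ fun _ _ => rfl
  · intro s hs
    simpa only [Finset.mem_coe, Fintype.mem_piFinset, Finset.mem_powerset] using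
      point_subset_iff.2 hs
  · intro A hA hA'
    rw [amb_of_single_eq_zero, zero_mul, zero_mul]
    rintro s rfl
    simp only [Fintype.mem_piFinset, Finset.mem_powerset] at hA
    exact hA' ⟨s, point_subset_iff.1 hA, rfl⟩

lemma amb_mul_of_single (y : TwistedShuffle S) (C : I → Finset ℕ) :
    amb S (y * of S (Pi.single k 1) f) C =
      ∑ s ∈ C k, amb S (of S (Pi.single k 1) f) (point k s) * amb S y (C \ point k s) *
        ambFac S (C \ point k s) (point k s) := by
  classical
  have hsd {s : ℕ} (hs : s ∈ C k) : C \ (C \ point k s) = point k s :=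
    sdiff_sdiff_eq_self (point_subset_iff.2 hs)
  rw [amb_mul, ambMul]
  symm
  refine Finset.sum_of_injOn (fun s => C \ point k s) ?_ ?_ ?_ ?_
  · intro s hs t ht h
    apply point_injective k
    rw [← hsd hs, ← hsd ht]
    exact congrArg _ h
  · intro s _
    simp only [Finset.mem_coe, Fintype.mem_piFinset, Finset.mem_powerset]
    exact fun i => Finset.sdiff_subset
  · intro A hA hA'
    simp only [Fintype.mem_piFinset, Finset.mem_powerset] at hA
    have hsdA : C \ (C \ A) = A := sdiff_sdiff_eq_self hA
    rw [amb_of_single_eq_zero, mul_zero, zero_mul]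
    intro s hs
    refine hA' ⟨s, point_subset_iff.1 fun i => ?_, ?_⟩
    · rw [← hs]
      exact Finset.sdiff_subset
    · dsimp only
      rw [← hs, hsdA]
  · intro s hs
    rw [hsd hs]
    ring

lemma amb_of_single_mul_of_single (C : I → Finset ℕ) :
    amb S (of S (Pi.single k 1) f * of S (Pi.single l 1) g) C =
      ∑ a ∈ C k, ∑ b ∈ C l, if C \ point k a = point l b then
        amb S (of S (Pi.single k 1) f) (point k a) * amb S (of S (Pi.single l 1) g) (point l b) *
          ambFac S (point k a) (point l b) else 0 := by
  rw [amb_of_single_mul]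
  refine Finset.sum_congr rfl fun a _ => ?_
  by_cases h : ∃ b, C \ point k a = point l b
  · obtain ⟨b, hb⟩ := h
    have hbC : b ∈ C l := point_subset_iff.1 fun i => hb ▸ Finset.sdiff_subset
    rw [Finset.sum_eq_single_of_mem b hbC, if_pos hb, hb]
    exact fun b' _ hb' => if_neg fun h => hb' (point_injective l (h.symm.trans hb))
  · push Not at h
    rw [amb_of_single_eq_zero g h, mul_zero, zero_mul,
      Finset.sum_eq_zero fun b _ => if_neg (h b)]

end DegreeOne

section Generators

variable (S : ShuffleDatum I R)

/-- The generator `(λ^{(k)})^r` of the shuffle algebra. -/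
def gen (k : I) (r : ℕ) : TwistedShuffle S := of S (Pi.single k 1) (lamPow R k r)

lemma amb_gen_point (k : I) (r s : ℕ) : amb S (gen S k r) (point k s) = ambVar R k s ^ r := by
  rw [gen, amb_of S _ _ (card_point k s)]
  simp only [lamPow, map_pow, aeval_X]
  have hmem (t : ℕ) (ht : t ∈ point k s k) : t = s := by
    rwa [point_self, Finset.mem_singleton] at ht
  rw [hmem _ (Finset.orderEmbOfFin_mem (point k s k) (card_point k s k) ⟨0, by simp⟩)]

/-- The relation between the factors of two points of colours `k` and `l` that encodes the quadratic
relation with parameter `c` between the generators of these colours. -/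
def IsQuadraticPair (k l : I) (c : R) : Prop :=
  ∀ a b, (k, a) ≠ (l, b) →
    (ambVar R k a - ambVar R l b - algebraMap R (AmbField I R) c) *
        ambFac S (point k a) (point l b) =
      (ambVar R k a - ambVar R l b + algebraMap R (AmbField I R) c) *
        ambFac S (point l b) (point k a)

/-- The factor of two distinct points of colour `k` is the rational function `(z + η) / z` of the
difference `z` of their variables. -/
def HasSelfFactor (k : I) (η : R) : Prop :=
  ∀ a b, a ≠ b → ambFac S (point k a) (point k b) =
    (ambVar R k a - ambVar R k b + algebraMap R (AmbField I R) η) /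
      (ambVar R k a - ambVar R k b)

variable {S}

lemma HasSelfFactor.isQuadraticPair {k : I} {η : R} (h : HasSelfFactor S k η) :
    IsQuadraticPair S k k η := by
  intro a b hab
  have hne : a ≠ b := fun e => hab (e ▸ rfl)
  have hab0 : ambVar R k a - ambVar R k b ≠ 0 := sub_ne_zero.2 ((ambVar_injective k).ne hne)
  have hba0 : ambVar R k b - ambVar R k a ≠ 0 := sub_ne_zero.2 ((ambVar_injective k).ne hne.symm)
  rw [h a b hne, h b a hne.symm]
  field_simp
  ring

lemma IsQuadraticPair.symm {k l : I} {c : R} (h : IsQuadraticPair S k l c) :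
    IsQuadraticPair S l k c := fun b a hab => by
  linear_combination h a b hab.symm

lemma IsQuadraticPair.quadratic [CharZero R] {k l : I} {c : R} (h : IsQuadraticPair S k l c)
    (r s : ℕ) :
    gen S k (r + 1) * gen S l s - gen S k r * gen S l (s + 1) - c • (gen S k r * gen S l s) =
    gen S l s * gen S k (r + 1) - gen S l (s + 1) * gen S k r
      + c • (gen S l s * gen S k r) := by
  apply amb_injective S
  funext C
  simp only [amb_sub, amb_add, amb_smul, Pi.sub_apply, Pi.add_apply, Pi.smul_apply]
  have hkl (p q : ℕ) := amb_of_single_mul_of_single (S := S) (lamPow R k p) (lamPow R l q) C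
  have hlk (p q : ℕ) := amb_of_single_mul_of_single (S := S) (lamPow R l p) (lamPow R k q) C
  simp only [← gen.eq_1] at hkl hlk
  simp only [hkl, hlk, Finset.sum_comm (s := C l), ← Finset.sum_sub_distrib,
    ← Finset.sum_add_distrib, Finset.smul_sum]
  refine Finset.sum_congr rfl fun a ha => Finset.sum_congr rfl fun b hb => ?_
  by_cases e : C \ point k a = point l b
  · simp only [if_pos e, if_pos (sdiff_point_eq_comm ha e), amb_gen_point, Algebra.smul_def]
    linear_combination (ambVar R k a ^ r * ambVar R l b ^ s) * h a b (ne_of_sdiff_point_eq e)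
  · have e' : ¬ C \ point l b = point k a := fun e' => e (sdiff_point_eq_comm hb e')
    simp only [if_neg e, if_neg e', smul_zero, sub_zero, add_zero]

end Generators

section Serre

attribute [local instance] LieRing.ofAssociativeRing

variable {S : ShuffleDatum I R} {k l : I}

lemma ambFac_point_update (s : ℕ) (A : I → Finset ℕ) (X : Finset ℕ) :
    ambFac S (point k s) (Function.update A k X) =
      (∏ t ∈ X, ambFac S (point k s) (point k t)) *
        ambFac S (point k s) (Function.update A k ∅) := by
  induction X using Finset.induction_on with
  | empty => rw [Finset.prod_empty, one_mul]
  | insert t X ht ih =>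
    have hsub : ∀ i, point k t i ⊆ Function.update A k (insert t X) i :=
      point_subset_iff.2 <| by rw [Function.update_self]; exact Finset.mem_insert_self t X
    rw [ambFac_right S _ hsub, sdiff_point, Function.update_self, Function.update_idem,
      Finset.erase_insert ht, ih, Finset.prod_insert ht, mul_assoc]

lemma ambFac_update_point (s : ℕ) (A : I → Finset ℕ) (X : Finset ℕ) :
    ambFac S (Function.update A k X) (point k s) =
      (∏ t ∈ X, ambFac S (point k t) (point k s)) *
        ambFac S (Function.update A k ∅) (point k s) := by
  induction X using Finset.induction_on with
  | empty => rw [Finset.prod_empty, one_mul]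
  | insert t X ht ih =>
    have hsub : ∀ i, point k t i ⊆ Function.update A k (insert t X) i :=
      point_subset_iff.2 <| by rw [Function.update_self]; exact Finset.mem_insert_self t X
    rw [ambFac_left S _ hsub, sdiff_point, Function.update_self, Function.update_idem,
      Finset.erase_insert ht, ih, Finset.prod_insert ht, mul_assoc]

lemma amb_ad_of_single [CharZero R] (f : SHDeg R (Pi.single k 1 : I → ℕ)) (y : TwistedShuffle S)
    (C : I → Finset ℕ) :
    amb S (LieAlgebra.ad ℤ _ (of S (Pi.single k 1) f) y) C =
      ∑ s ∈ C k, amb S (of S (Pi.single k 1) f) (point k s) * amb S y (C \ point k s) *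
        (ambFac S (point k s) (C \ point k s) - ambFac S (C \ point k s) (point k s)) := by
  rw [LieAlgebra.ad_apply, Ring.lie_def, amb_sub, Pi.sub_apply, amb_of_single_mul,
    amb_mul_of_single, ← Finset.sum_sub_distrib]
  exact Finset.sum_congr rfl fun s _ => (mul_sub ..).symm

lemma amb_ad_pow_of_single_eq_zero [CharZero R] (hkl : k ≠ l)
    (f : SHDeg R (Pi.single k 1 : I → ℕ)) (g : SHDeg R (Pi.single l 1 : I → ℕ)) (n : ℕ)
    {C : I → Finset ℕ} (hC : ∀ b X, X.card = n → C ≠ Function.update (point l b) k X) :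
    amb S ((LieAlgebra.ad ℤ _ (of S (Pi.single k 1) f) ^ n) (of S (Pi.single l 1) g)) C = 0 := by
  induction n generalizing C with
  | zero =>
    refine amb_of_single_eq_zero g fun b => ?_
    rw [← update_point_empty hkl b]
    exact hC b ∅ Finset.card_empty
  | succ n ih =>
    rw [pow_succ', Module.End.mul_apply, amb_ad_of_single]
    refine Finset.sum_eq_zero fun s hs => ?_
    rw [ih, mul_zero, zero_mul]
    rintro b X rfl hX
    rw [sdiff_point] at hX
    have hXk : (C k).erase s = X := by simpa only [Function.update_self] using congrFun hX k
    refine hC b (C k) (by rw [← hXk, Finset.card_erase_add_one hs]) ?_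
    simpa only [Function.update_idem, Function.update_eq_self] using
      congrArg (Function.update · k (C k)) hX

variable (S k l) in
/-- The common part of the factors of a point of colour `k` and a point of colour `l` taken in
either order, when the two colours satisfy the quadratic relation with parameter `c`. -/
def reducedFac (c : R) (b t : ℕ) : AmbField I R :=
  ambFac S (point k t) (point l b) /
    (ambVar R l b - ambVar R k t - algebraMap R (AmbField I R) c)

lemma ambFac_point_eq_mul_reducedFac (hkl : k ≠ l) (c : R) (t b : ℕ) :
    ambFac S (point k t) (point l b) =
      (ambVar R l b - ambVar R k t - algebraMap R (AmbField I R) c) * reducedFac S k l c b t :=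
  (mul_div_cancel₀ _ (ambVar_sub_sub_ne_zero (fun e => hkl (Prod.mk_inj.1 e).1.symm) c)).symm

lemma IsQuadraticPair.ambFac_point_swap_eq_mul_reducedFac {c : R} (h : IsQuadraticPair S k l c)
    (hkl : k ≠ l) (t b : ℕ) :
    ambFac S (point l b) (point k t) =
      (ambVar R l b - ambVar R k t + algebraMap R (AmbField I R) c) * reducedFac S k l c b t := by
  apply mul_left_cancel₀
    (ambVar_sub_sub_ne_zero (fun e : (l, b) = (k, t) => hkl (Prod.mk_inj.1 e).1.symm) c)
  have hswap := h t b fun e => hkl (Prod.mk_inj.1 e).1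
  rw [ambFac_point_eq_mul_reducedFac hkl c] at hswap
  linear_combination hswap

variable {c η : R}

lemma IsQuadraticPair.sum_commutator_step (h : IsQuadraticPair S k l c) (hk : HasSelfFactor S k η)
    (hkl : k ≠ l) (b : ℕ) (X : Finset ℕ) (u : ℕ → AmbField I R) :
    ∑ s ∈ X, u s * (∏ t ∈ X.erase s, u t * reducedFac S k l c b t) *
        (ambFac S (point k s) (Function.update (point l b) k (X.erase s)) -
          ambFac S (Function.update (point l b) k (X.erase s)) (point k s)) =
      algebraMap R (AmbField I R) (X.card * (-2 * c - (X.card - 1) * η)) *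
        ∏ t ∈ X, u t * reducedFac S k l c b t := by
  have hkk' (s t : ℕ) (hst : t ≠ s) : ambFac S (point k t) (point k s) =
      (ambVar R k s - ambVar R k t - algebraMap R (AmbField I R) η) /
        (ambVar R k s - ambVar R k t) := by
    rw [hk t s hst, ← neg_div_neg_eq]
    congr 1 <;> ring
  have hlagrange := sum_lagrange_difference (s := X) (ambVar_injective (R := R) k).injOn
    (algebraMap R (AmbField I R) η) (ambVar R l b) (algebraMap R (AmbField I R) (-c))
  simp only [map_mul, map_sub, map_neg, map_natCast, map_ofNat, map_one] at hlagrange ⊢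
  rw [neg_mul_comm, ← hlagrange, Finset.sum_mul]
  refine Finset.sum_congr rfl fun s hs => ?_
  rw [ambFac_point_update, ambFac_update_point, update_point_empty hkl,
    Finset.prod_congr rfl fun t ht => hk s t (Finset.ne_of_mem_erase ht).symm,
    Finset.prod_congr rfl fun t ht => hkk' s t (Finset.ne_of_mem_erase ht),
    ambFac_point_eq_mul_reducedFac hkl c, h.ambFac_point_swap_eq_mul_reducedFac hkl,
    ← Finset.mul_prod_erase X _ hs]
  ring

variable [CharZero R]

lemma IsQuadraticPair.amb_ad_pow (h : IsQuadraticPair S k l c) (hk : HasSelfFactor S k η)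
    (hkl : k ≠ l) (f : SHDeg R (Pi.single k 1 : I → ℕ)) (g : SHDeg R (Pi.single l 1 : I → ℕ))
    (b : ℕ) (X : Finset ℕ) :
    amb S ((LieAlgebra.ad ℤ _ (of S (Pi.single k 1) f) ^ X.card) (of S (Pi.single l 1) g))
        (Function.update (point l b) k X) =
      algebraMap R (AmbField I R) (∏ j ∈ Finset.range X.card, (j + 1) * (-2 * c - j * η)) *
        (∏ t ∈ X, amb S (of S (Pi.single k 1) f) (point k t) * reducedFac S k l c b t) *
        amb S (of S (Pi.single l 1) g) (point l b) := by
  induction hn : X.card generalizing X with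
  | zero =>
    rw [Finset.card_eq_zero.1 hn, update_point_empty hkl]
    simp
  | succ n ih =>
    have hstep := h.sum_commutator_step hk hkl b X fun t =>
      amb S (of S (Pi.single k 1) f) (point k t)
    rw [pow_succ', Module.End.mul_apply, amb_ad_of_single, Function.update_self,
      Finset.prod_range_succ, map_mul]
    simp only [hn, Nat.cast_succ, add_sub_cancel_right] at hstep
    rw [mul_assoc (algebraMap R (AmbField I R) _), ← hstep, Finset.mul_sum, Finset.sum_mul]
    refine Finset.sum_congr rfl fun s hs => ?_
    rw [sdiff_point, Function.update_idem, Function.update_self, ih (X.erase s)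
      (by rw [Finset.card_erase_of_mem hs, hn, Nat.add_sub_cancel])]
    ring

lemma IsQuadraticPair.ad_pow_eq_zero (h : IsQuadraticPair S k l c) (hk : HasSelfFactor S k η)
    (hkl : k ≠ l) (f : SHDeg R (Pi.single k 1 : I → ℕ)) (g : SHDeg R (Pi.single l 1 : I → ℕ))
    {m : ℕ} (hm : -2 * c = m * η) :
    (LieAlgebra.ad ℤ _ (of S (Pi.single k 1) f) ^ (m + 1)) (of S (Pi.single l 1) g) = 0 := by
  apply amb_injective S
  rw [amb_zero]
  funext C
  by_cases hC : ∃ b X, X.card = m + 1 ∧ C = Function.update (point l b) k X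
  · obtain ⟨b, X, hX, rfl⟩ := hC
    rw [← hX, h.amb_ad_pow hk hkl, hX, Finset.prod_range_succ, hm, sub_self, mul_zero, mul_zero,
      map_zero, zero_mul, zero_mul, Pi.zero_apply]
  · push Not at hC
    exact amb_ad_pow_of_single_eq_zero hkl f g _ hC

lemma IsQuadraticPair.serre (h : IsQuadraticPair S k l c) (hk : HasSelfFactor S k η)
    (hkl : k ≠ l) {m : ℕ} (hm : -2 * c = m * η) (r : Fin (m + 1) → ℕ) (s : ℕ) :
    ∑ σ : Equiv.Perm (Fin (m + 1)),
      (List.ofFn fun p => gen S k (r (σ p))).foldr (fun a b => a * b - b * a) (gen S l s) = 0 := by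
  refine sum_perm_foldr_commutator_eq_zero (fun i => gen S k (r i)) fun T => ?_
  simp only [gen, ← map_sum]
  exact h.ad_pow_eq_zero hk hkl _ _ hm

end Serre

section PointFactors

variable {S : ShuffleDatum I R}

lemma ambFac_point_same {k : I} (hk : ∀ h, ¬ (S.quiver.out h = k ∧ S.quiver.inc h = k))
    (a b : ℕ) :
    ambFac S (point k a) (point k b) = (ambVar R k b - ambVar R k a +
      algebraMap R (AmbField I R) (S.weight.vertex k * S.t₃)) / (ambVar R k b - ambVar R k a) := by
  unfold ambFac
  rw [Finset.sum_eq_zero, pow_zero, one_mul, Finset.prod_eq_single k,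
    Finset.prod_eq_one (s := (Finset.univ : Finset S.quiver.Arrow)), mul_one]
  · simp only [prod_point, if_true]
  · intro h _
    have := hk h
    simp only [prod_point]
    split_ifs <;> simp_all
  · intro i _ hi
    rw [prod_point, if_neg hi]
  · simp
  · intro h _
    have := hk h
    simp only [card_point, Pi.single_apply]
    split_ifs <;> simp_all

lemma ambFac_point_of_ne {k l : I} (hkl : k ≠ l) (a b : ℕ) :
    ambFac S (point k a) (point l b) = ∏ h : S.quiver.Arrow,
      ((if S.quiver.out h = k ∧ S.quiver.inc h = l then
        ambVar R l b - ambVar R k a + algebraMap R (AmbField I R) (S.weight.arrow h * S.t₁)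
        else 1) *
      if S.quiver.out h = l ∧ S.quiver.inc h = k then
        ambVar R k a - ambVar R l b - algebraMap R (AmbField I R) (S.weight.opArrow h * S.t₂)
        else 1) := by
  unfold ambFac
  rw [← Finset.prod_pow_eq_pow_sum, Finset.prod_eq_one (s := (Finset.univ : Finset I)), mul_one,
    ← Finset.prod_mul_distrib]
  · refine Finset.prod_congr rfl fun h _ => ?_
    simp only [prod_point, card_point, Pi.single_apply]
    by_cases hout : S.quiver.out h = k ∧ S.quiver.inc h = l
    · simp [hout, hkl, hkl.symm]
    by_cases hinc : S.quiver.out h = l ∧ S.quiver.inc h = k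
    · simp only [hinc, hkl, hkl.symm, if_true, if_false, and_self]
      ring
    · split_ifs <;> simp_all
  · intro i _
    simp only [prod_point]
    split_ifs with hik hil
    · exact absurd (hik.symm.trans hil) hkl
    · rfl
    · rfl

end PointFactors

section Cartan

variable {n : ℕ} {A : Matrix (Fin n) (Fin n) ℤ} {d : Fin n → ℕ}

/-- The scalar `d_k a_{kl} ħ / 2`, the image in `ℂ[ħ]` of `yangianScalar`. -/
def halfForm (A : Matrix (Fin n) (Fin n) ℤ) (d : Fin n → ℕ) (k l : Fin n) : Polynomial ℂ :=
  Polynomial.C ((d k * A k l : ℂ) / 2) * Polynomial.X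

lemma halfForm_comm (hA : IsCartanWithSymmetrizer A d) (k l : Fin n) :
    halfForm A d k l = halfForm A d l k := by
  have h := congrArg (Int.cast : ℤ → ℂ) (hA.symm k l)
  push_cast at h
  rw [halfForm, halfForm, h]

lemma two_mul_halfForm (k l : Fin n) :
    2 * halfForm A d k l = (A k l : Polynomial ℂ) * ((d k : Polynomial ℂ) * Polynomial.X) := by
  have hC : (2 : Polynomial ℂ) = Polynomial.C 2 := rfl
  rw [halfForm, hC, ← Polynomial.C_eq_natCast, ← Polynomial.C_eq_intCast, ← mul_assoc, ← mul_assoc,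
    ← Polynomial.C_mul, ← Polynomial.C_mul]
  congr 2
  ring

lemma halfForm_self {k : Fin n} (hk : A k k = 2) :
    halfForm A d k k = (d k : Polynomial ℂ) * Polynomial.X := by
  have h := two_mul_halfForm (A := A) (d := d) k k
  rw [hk, Int.cast_ofNat] at h
  exact mul_left_cancel₀ two_ne_zero h

lemma hasSelfFactor_cartanDatum (k : Fin n) :
    HasSelfFactor (cartanDatum A d) k ((d k : Polynomial ℂ) * Polynomial.X) := by
  intro a b _
  rw [ambFac_point_same fun (h : (cartanQuiver A).Arrow) hc => h.1.2.ne (hc.1.trans hc.2.symm),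
    ← neg_div_neg_eq]
  congr 1
  · simp only [cartanDatum, cartanWeight, Int.cast_natCast, mul_neg, map_neg]
    ring
  · ring

lemma prod_arrow_eq {k l : Fin n} (hkl : k < l) {M : Type*} [CommMonoid M]
    (φ : (cartanQuiver A).Arrow → M)
    (hφ : ∀ h, ¬ ((cartanQuiver A).out h = k ∧ (cartanQuiver A).inc h = l) → φ h = 1) :
    ∏ h, φ h = ∏ p : Fin (Int.gcd (A k l) (A l k)), φ ⟨⟨(k, l), hkl⟩, p⟩ := by
  refine (Fintype.prod_sigma (fun h => φ h)).trans ?_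
  refine Fintype.prod_eq_single (⟨(k, l), hkl⟩ : {p : Fin n × Fin n // p.1 < p.2}) ?_
  rintro ⟨⟨i, j⟩, hij⟩ hne
  refine Finset.prod_eq_one fun p _ => hφ _ ?_
  rintro ⟨rfl : i = k, rfl : j = l⟩
  exact hne rfl

/-- The scalar `e_{kl} ħ / 2` with `e_{kl} = d_k |a_{kl} / gcd(a_{kl}, a_{lk})|`: the weights of
consecutive arrows from `k` to `l` differ by twice this scalar. -/
def halfStep (A : Matrix (Fin n) (Fin n) ℤ) (d : Fin n → ℕ) (k l : Fin n) : Polynomial ℂ :=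
  Polynomial.C ((d k * (cartanQuiver A).l k l : ℂ) / 2) * Polynomial.X

lemma gcd_mul_halfStep {k l : Fin n} (hkl : A k l ≤ 0) :
    (Int.gcd (A k l) (A l k) : Polynomial ℂ) * halfStep A d k l = -halfForm A d k l := by
  have hgcd : (Int.gcd (A k l) (A l k) : ℤ) * ((cartanQuiver A).l k l : ℤ) = -A k l := by
    have hdiv := congrArg abs (Int.mul_ediv_cancel' (Int.gcd_dvd_left (A k l) (A l k)))
    rwa [abs_mul, Nat.abs_cast, abs_of_nonpos hkl, Int.abs_eq_natAbs] at hdiv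
  have hgcd' := congrArg (Int.cast : ℤ → ℂ) hgcd
  push_cast at hgcd'
  rw [halfStep, halfForm, ← mul_assoc, ← neg_mul, ← Polynomial.C_neg,
    ← map_natCast Polynomial.C, ← Polynomial.C_mul]
  congr 2
  linear_combination (d k / 2 : ℂ) * hgcd'

lemma not_out_inc_of_lt {k l : Fin n} (hkl : k < l) (h : (cartanQuiver A).Arrow) :
    ¬ ((cartanQuiver A).out h = l ∧ (cartanQuiver A).inc h = k) := fun hc =>
  lt_asymm hkl (hc.1 ▸ hc.2 ▸ (h.1.2 : (cartanQuiver A).out h < (cartanQuiver A).inc h))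

lemma ambFac_point_of_lt {k l : Fin n} (hkl : k < l) (a b : ℕ) :
    ambFac (cartanDatum A d) (point k a) (point l b) =
      ∏ p : Fin (Int.gcd (A k l) (A l k)),
        (ambVar (Polynomial ℂ) l b - ambVar (Polynomial ℂ) k a +
          algebraMap (Polynomial ℂ) _
            ((Int.gcd (A k l) (A l k) - 2 * (p : ℕ)) * halfStep A d k l)) := by
  rw [ambFac_point_of_ne hkl.ne]
  refine (prod_arrow_eq hkl _ fun h hh => ?_).trans (Finset.prod_congr rfl fun p _ => ?_)
  · exact (congrArg₂ (· * ·) (if_neg hh) (if_neg (not_out_inc_of_lt hkl h))).trans (one_mul 1)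
  · refine (congrArg₂ (· * ·) (if_pos ⟨rfl, rfl⟩)
      (if_neg (not_out_inc_of_lt hkl _))).trans ((mul_one _).trans ?_)
    congr 2
    simp only [cartanDatum, cartanWeight, halfStep, div_eq_mul_inv, Polynomial.C_mul,
      Polynomial.C_1, map_natCast]
    push_cast
    ring

lemma ambFac_point_of_gt {k l : Fin n} (hkl : k < l) (a b : ℕ) :
    ambFac (cartanDatum A d) (point l b) (point k a) =
      ∏ p : Fin (Int.gcd (A k l) (A l k)),
        (ambVar (Polynomial ℂ) l b - ambVar (Polynomial ℂ) k a +
          algebraMap (Polynomial ℂ) _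
            ((Int.gcd (A k l) (A l k) - 2 * ((p : ℕ) + 1)) * halfStep A d k l)) := by
  rw [ambFac_point_of_ne hkl.ne']
  refine (prod_arrow_eq hkl _ fun h hh => ?_).trans (Finset.prod_congr rfl fun p _ => ?_)
  · exact (congrArg₂ (· * ·) (if_neg (not_out_inc_of_lt hkl h)) (if_neg hh)).trans (one_mul 1)
  · refine (congrArg₂ (· * ·) (if_neg (not_out_inc_of_lt hkl _))
      (if_pos ⟨rfl, rfl⟩)).trans ((one_mul _).trans ?_)
    rw [sub_eq_add_neg _ (algebraMap _ _ _), ← map_neg]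
    congr 2
    simp only [cartanDatum, cartanWeight, halfStep, div_eq_mul_inv, Polynomial.C_mul,
      Polynomial.C_1, map_natCast]
    push_cast
    ring

lemma isQuadraticPair_cartanDatum_of_lt {k l : Fin n} (hkl : k < l) (hneg : A k l ≤ 0) :
    IsQuadraticPair (cartanDatum A d) k l (halfForm A d k l) := by
  intro a b _
  rw [ambFac_point_of_lt hkl, ambFac_point_of_gt hkl, ← neg_neg (halfForm A d k l),
    ← gcd_mul_halfStep hneg]
  simp only [map_neg, map_mul, map_sub, map_add, map_natCast, map_ofNat, map_one]
  linear_combination -mul_prod_progression_shift (Int.gcd (A k l) (A l k))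
    (ambVar (Polynomial ℂ) l b - ambVar (Polynomial ℂ) k a)
    (algebraMap (Polynomial ℂ) _ (halfStep A d k l))

theorem isQuadraticPair_cartanDatum (hA : IsCartanWithSymmetrizer A d) (k l : Fin n) :
    IsQuadraticPair (cartanDatum A d) k l (halfForm A d k l) := by
  rcases lt_trichotomy k l with hkl | rfl | hkl
  · exact isQuadraticPair_cartanDatum_of_lt hkl (hA.nonpos k l hkl.ne)
  · rw [halfForm_self (hA.diag k)]
    exact (hasSelfFactor_cartanDatum k).isQuadraticPair
  · rw [halfForm_comm hA]
    exact (isQuadraticPair_cartanDatum_of_lt hkl (hA.nonpos l k hkl.ne)).symm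

theorem serre_cartanDatum (hA : IsCartanWithSymmetrizer A d) {k l : Fin n} (hkl : k ≠ l)
    (r : Fin (1 - A k l).toNat → ℕ) (s : ℕ) :
    ∑ σ : Equiv.Perm (Fin (1 - A k l).toNat),
      (List.ofFn fun p => gen (cartanDatum A d) k (r (σ p))).foldr (fun a b => a * b - b * a)
        (gen (cartanDatum A d) l s) = 0 := by
  obtain ⟨m, hm⟩ := Int.eq_ofNat_of_zero_le (neg_nonneg.2 (hA.nonpos k l hkl))
  have hparam : -2 * halfForm A d k l =
      (m : Polynomial ℂ) * ((d k : Polynomial ℂ) * Polynomial.X) := by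
    rw [neg_mul, two_mul_halfForm, ← neg_mul, ← Int.cast_neg, hm, Int.cast_natCast]
  have hN : (1 - A k l).toNat = m + 1 := by omega
  revert r
  rw [hN]
  exact fun r =>
    (isQuadraticPair_cartanDatum hA k l).serre (hasSelfFactor_cartanDatum k) hkl hparam r s

end Cartan

end TwistedShuffle

section Homomorphism

lemma map_foldr_commutator {B B' F : Type*} [Ring B] [Ring B'] [FunLike F B B']
    [RingHomClass F B B'] (f : F) (L : List B) (y : B) :
    f (L.foldr (fun a b => a * b - b * a) y) =
      (L.map f).foldr (fun a b => a * b - b * a) (f y) := by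
  rw [List.foldr_map]
  exact List.foldr_hom f (g₂ := fun a b => f a * b - b * f a)
    (fun a b => by rw [map_sub, map_mul, map_mul]) |>.symm

variable {n : ℕ} {A : Matrix (Fin n) (Fin n) ℤ} {d : Fin n → ℕ}
  {B : Type*} [Ring B] [Algebra (Polynomial ℚ) B]

variable (A d) in
/-- The family `X k r` of elements of a `ℚ[ħ]`-algebra satisfies the defining relations of the
positive Yangian. -/
structure SatisfiesYangianRelations (X : Fin n → ℕ → B) : Prop where
  quadratic (k l : Fin n) (r s : ℕ) :
    X k (r + 1) * X l s - X k r * X l (s + 1) - yangianScalar A d k l • (X k r * X l s) =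
      X l s * X k (r + 1) - X l (s + 1) * X k r + yangianScalar A d k l • (X l s * X k r)
  serre (k l : Fin n) (hkl : k ≠ l) (r : Fin (1 - A k l).toNat → ℕ) (s : ℕ) :
    ∑ σ : Equiv.Perm (Fin (1 - A k l).toNat),
      (List.ofFn fun p => X k (r (σ p))).foldr (fun a b => a * b - b * a) (X l s) = 0

lemma SatisfiesYangianRelations.lift_eq_lift_of_rel {X : Fin n → ℕ → B}
    (hX : SatisfiesYangianRelations A d X) {a b : FreeAlgebra (Polynomial ℚ) (Fin n × ℕ)}
    (h : YangianRel A d a b) :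
    FreeAlgebra.lift (Polynomial ℚ) (Function.uncurry X) a =
      FreeAlgebra.lift (Polynomial ℚ) (Function.uncurry X) b := by
  have hgen (k : Fin n) (r : ℕ) :
      FreeAlgebra.lift (Polynomial ℚ) (Function.uncurry X) (freeGen n k r) = X k r :=
    FreeAlgebra.lift_ι_apply _ _
  cases h with
  | quadratic k l r s =>
    simpa only [map_sub, map_add, map_smul, map_mul, hgen] using hX.quadratic k l r s
  | serre k l hkl r s =>
    simpa only [map_zero, map_sum, map_foldr_commutator, List.map_ofFn, Function.comp_def, hgen]
      using hX.serre k l hkl r s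

/-- The homomorphism from the positive Yangian given by a family of elements satisfying its defining
relations. -/
def SatisfiesYangianRelations.lift {X : Fin n → ℕ → B} (hX : SatisfiesYangianRelations A d X) :
    PositiveYangian A d →ₐ[Polynomial ℚ] B :=
  RingQuot.liftAlgHom (Polynomial ℚ)
    ⟨FreeAlgebra.lift (Polynomial ℚ) (Function.uncurry X), fun _ _ => hX.lift_eq_lift_of_rel⟩

lemma SatisfiesYangianRelations.lift_x {X : Fin n → ℕ → B}
    (hX : SatisfiesYangianRelations A d X) (k : Fin n) (r : ℕ) :
    hX.lift (PositiveYangian.x A d k r) = X k r := by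
  rw [lift, PositiveYangian.x, RingQuot.liftAlgHom_mkAlgHom_apply]
  exact FreeAlgebra.lift_ι_apply _ _

lemma PositiveYangian.algHom_ext {φ ψ : PositiveYangian A d →ₐ[Polynomial ℚ] B}
    (h : ∀ k r, φ (x A d k r) = ψ (x A d k r)) : φ = ψ :=
  RingQuot.ringQuot_ext' _ _ _ <| FreeAlgebra.hom_ext <| funext fun p => h p.1 p.2

lemma yangianScalar_smul (k l : Fin n) (a : CartanShuffle A d) :
    yangianScalar A d k l • a = TwistedShuffle.halfForm A d k l • a := by
  change (Polynomial.mapRingHom (algebraMap ℚ ℂ)) (yangianScalar A d k l) • a = _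
  congr 1
  simp [yangianScalar, TwistedShuffle.halfForm]

theorem IsCartanWithSymmetrizer.satisfiesYangianRelations_gen (hA : IsCartanWithSymmetrizer A d) :
    SatisfiesYangianRelations A d (TwistedShuffle.gen (cartanDatum A d)) where
  quadratic k l r s := by
    simp only [yangianScalar_smul]
    exact (TwistedShuffle.isQuadraticPair_cartanDatum hA k l).quadratic r s
  serre _ _ hkl := TwistedShuffle.serre_cartanDatum hA hkl

end Homomorphism

end
end ShuffleYangian

theorem mainTheorem1_general (n : ℕ) (A : Matrix (Fin n) (Fin n) ℤ) (d : Fin n → ℕ)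
    (hA : IsCartanWithSymmetrizer A d) :
    ∃! φ : PositiveYangian A d →ₐ[Polynomial ℚ] CartanShuffle A d,
      ∀ (k : Fin n) (r : ℕ), φ (PositiveYangian.x A d k r) =
        TwistedShuffle.of (cartanDatum A d) (Pi.single k 1)
          (TwistedShuffle.lamPow (Polynomial ℂ) k r) :=
  ⟨hA.satisfiesYangianRelations_gen.lift, hA.satisfiesYangianRelations_gen.lift_x, fun _ hψ =>
    PositiveYangian.algHom_ext fun k r =>
      (hψ k r).trans (hA.satisfiesYangianRelations_gen.lift_x k r).symm⟩

theorem mainTheorem1 (n : ℕ) (A : Matrix (Fin n) (Fin n) ℤ) (d : Fin n → ℕ)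
    (hA : IsCartanWithSymmetrizer A d) (hd : Finset.univ.gcd d = 1) :
    ∃! φ : PositiveYangian A d →ₐ[Polynomial ℚ] CartanShuffle A d,
      ∀ (k : Fin n) (r : ℕ), φ (PositiveYangian.x A d k r) =
        TwistedShuffle.of (cartanDatum A d) (Pi.single k 1)
          (TwistedShuffle.lamPow (Polynomial ℂ) k r) :=
  mainTheorem1_general n A d hA
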